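/- Let $\Theta$ be a probability distribution on $(\mathbb{R}\cup\{+\infty\})^{\mathbb{N}^*}$, the offspring law of a branching random walk: a particle at $y$ has children at $y+x_1,y+x_2,\dots$, where $(x_1,x_2,\dots)$ has law $\Theta$, reproduction events are independent, and the value $+\infty$ means that the child does not exist. Sums over children ignore non-existing ones. Assume $$\mathbb{E}_\Theta\Big[\sum_i 1\Big]>1,\qquad \mathbb{E}_\Theta\Big[\sum_i e^{-x_i}\Big]=1,\qquad \mathbb{E}_\Theta\Big[\sum_i x_ie^{-x_i}\Big]=0,\qquad \mathbb{E}_\Theta\Big[\sum_i x_i^2e^{-x_i}\Big]\in(0,\infty).$$ For $x\in\mathbb{R}$ let $\mathbb{P}^*_x$ be the law of the spinal branching random walk: a particle $\xi_0$ starts at $x$; at each generation $n$ all particles reproduce independently, every particle other than $\xi_n$ according to $\Theta$, and $\xi_n$ according to the size-biased law $\Theta^*$ given by $\frac{d\Theta^*}{d\Theta}(x_1,x_2,\dots)=\sum_i e^{-x_i}$; given its offspring, $\xi_{n+1}$ is chosen among the children $u$ of $\xi_n$ with probability proportional to $e^{-X_u}$. Here $X_u$ is the position of the particle $u$. Let $\mathcal{F}_n$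 be the $\sigma$-algebra generated by the positions of the particles of generation at most $n$ and by $\xi_0,\dots,\xi_n$. Let $$R(x)=\sum_{n\ge0}\mathbb{P}^*_0\Big(X_{\xi_n}\ge -x,\ X_{\xi_n}<\min_{0\le k<n}X_{\xi_k}\Big)$$ be the renewal function of the strictly descending ladder heights of $(X_{\xi_n})_{n\ge0}$ (the condition on the minimum is void for $n=0$). For $x\ge0$ there is a probability measure $\mathbb{P}^+_x$ with $$\frac{d\mathbb{P}^+_x}{d\mathbb{P}^*_x}\Big|_{\mathcal{F}_n}=\frac{R(X_{\xi_n})}{R(x)}\,\mathbf{1}_{\min_{k\le n}X_{\xi_k}\ge0}\qquad\text{for all }n\ge0;$$ denote its expectation by $\mathbb{E}^+_x$. Let $f:\mathbb{R}_+\to\mathbb{R}_+$ be a bounded, non-increasing function with $\int_0^\infty yf(y)\,dy<\infty$. Then $$\mathbb{E}^+_x\Big[\sum_{k=0}^\infty f(X_{\xi_k})\Big]\longrightarrow0\quad\text{as }x\to\infty,$$ and this expectation is finite for every $x\ge0$. -/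

import Mathlib

open MeasureTheory Filter Topology
open scoped ENNReal

noncomputable section

namespace SpinalBRW

/-- A realization of the offspring of one particle: the displacements of its children, indexed by
`ℕ`; the value `⊤` in a slot means that the corresponding child does not exist. -/
abbrev Offspring : Type := ℕ → WithTop ℝ

/-- `e^{-a}`, with `e^{-∞} = 0`. -/
def weight (a : WithTop ℝ) : ℝ≥0∞ :=
  a.recTopCoe 0 fun r : ℝ => ENNReal.ofReal (Real.exp (-r))

/-- `a² e^{-a}` for an existing child, and `0` for a missing one. -/
def sqWeight (a : WithTop ℝ) : ℝ≥0∞ :=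
  a.recTopCoe 0 fun r : ℝ => ENNReal.ofReal (r ^ 2 * Real.exp (-r))

/-- `a e^{-a}` for an existing child, and `0` for a missing one. -/
def linWeight (a : WithTop ℝ) : ℝ :=
  a.recTopCoe 0 fun r : ℝ => r * Real.exp (-r)

/-- `1` for an existing child, and `0` for a missing one. -/
def countWeight (a : WithTop ℝ) : ℝ≥0∞ :=
  a.recTopCoe 0 fun _ : ℝ => 1

/-- The standing assumptions on the offspring law `Θ`: it is supercritical, in the boundary case,
and its variance parameter `σ²` is in `(0, ∞)`. Under `total_weight` and `variance_lt_top`, the function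
under the Bochner integral in `mean` is an almost surely absolutely convergent sum and integrable. -/
structure IsBoundaryCase (Θ : Measure Offspring) : Prop where
  prob : IsProbabilityMeasure Θ
  supercritical : 1 < ∫⁻ θ, ∑' i, countWeight (θ i) ∂Θ
  total_weight : ∫⁻ θ, ∑' i, weight (θ i) ∂Θ = 1
  mean : ∫ θ, ∑' i, linWeight (θ i) ∂Θ = 0
  variance_pos : 0 < ∫⁻ θ, ∑' i, sqWeight (θ i) ∂Θ
  variance_lt_top : ∫⁻ θ, ∑' i, sqWeight (θ i) ∂Θ < ∞

/-- The size-biased reproduction law `Θ*`, with `dΘ*/dΘ (x₁, x₂, …) = ∑ᵢ e^{-xᵢ}`. -/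
def sizeBiased (Θ : Measure Offspring) : Measure Offspring :=
  Θ.withDensity fun θ => ∑' i, weight (θ i)

/-- The joint law of the offspring of a spine particle and of the index of the child that continues
the spine: the offspring has law `Θ*` and, given it, child `i` is chosen with probability
proportional to `e^{-xᵢ}`. -/
def spineStep (Θ : Measure Offspring) : Measure (Offspring × ℕ) :=
  Measure.sum fun i : ℕ =>
    ((sizeBiased Θ).withDensity fun θ => weight (θ i) / ∑' j, weight (θ j)).map fun θ => (θ, i)

/-- Vertices of the Ulam-Harris tree: finite words over `ℕ`, the last letter being written first,
so that `i :: u` is the `i`-th child of `u`, `[]` is the root, and the length is the generation. -/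
abbrev Vertex : Type := List ℕ

/-- The first `n` letters of an infinite word, i.e. the vertex of generation `n` on a ray. -/
def rayVertex (r : ℕ → ℕ) : ℕ → Vertex
  | 0 => []
  | n + 1 => r n :: rayVertex r n

/-- The randomness driving the spinal branching random walk: the offspring of each particle off the
spine, and the offspring and the chosen child for each particle on the spine. -/
abbrev Noise : Type := (Vertex → Offspring) × (ℕ → Offspring × ℕ)

/-- All reproduction events are independent, with law `Θ` off the spine and `spineStep Θ` on it. -/
def noiseLaw (Θ : Measure Offspring) : Measure Noise :=
  (Measure.infinitePi fun _ : Vertex => Θ).prod (Measure.infinitePi fun _ : ℕ => spineStep Θ)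

/-- The ray of the tree that the spine follows. -/
def noiseRay (ν : Noise) : ℕ → ℕ := fun n => (ν.2 n).2

/-- The displacements of the children of the particle `u`. -/
def noiseOffspring (ν : Noise) (u : Vertex) : Offspring :=
  if u = rayVertex (noiseRay ν) u.length then (ν.2 u.length).1 else ν.1 u

/-- The positions of all particles, when the root is at `x`; non-existing particles (in particular
all descendants of a non-existing particle) are at `⊤`. -/
def noisePosition (x : ℝ) (ν : Noise) : Vertex → WithTop ℝ
  | [] => (x : WithTop ℝ)
  | i :: u => noisePosition x ν u + noiseOffspring ν u i

/-- The canonical space of branching random walks with a spine: positions of all particles, and a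
distinguished ray. -/
abbrev Path : Type := (Vertex → WithTop ℝ) × (ℕ → ℕ)

/-- The law `P*_x` of the spinal branching random walk started from a particle at `x`. -/
def spinalLaw (Θ : Measure Offspring) (x : ℝ) : Measure Path :=
  (noiseLaw Θ).map fun ν => (noisePosition x ν, noiseRay ν)

/-- The spine vertex `ξ_n`. -/
def spine (n : ℕ) (ω : Path) : Vertex := rayVertex ω.2 n

/-- The position `X_{ξ_n}` of the spine as a real number (it is almost surely not `⊤`). -/
def spinePos (n : ℕ) (ω : Path) : ℝ := (ω.1 (spine n ω)).untopD 0

/-- The σ-algebra `F_n` generated by the positions `X_u` with `|u| ≤ n` and by `ξ_0, …, ξ_n`. -/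
@[reducible] def sigmaUpTo (n : ℕ) : MeasurableSpace Path :=
  (⨆ u : Vertex, ⨆ _ : u.length ≤ n,
    MeasurableSpace.comap (fun ω : Path => ω.1 u) inferInstance) ⊔
  (⨆ k : ℕ, ⨆ _ : k ≤ n, MeasurableSpace.comap (spine k) ⊤)

/-- The renewal function of the strictly descending ladder heights of the spine,
`R(x) = ∑ₙ P*(X_{ξ_n} ≥ -x, X_{ξ_n} < min_{k < n} X_{ξ_k})`. -/
def renewal (Θ : Measure Offspring) (x : ℝ) : ℝ≥0∞ :=
  ∑' n : ℕ, spinalLaw Θ 0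
    {ω | -x ≤ spinePos n ω ∧ ∀ k < n, spinePos n ω < spinePos k ω}

open Classical in
/-- `R(X_{ξ_n}) 1_{min_{k ≤ n} X_{ξ_k} ≥ 0} / R(x)`. -/
def positiveDensity (Θ : Measure Offspring) (x : ℝ) (n : ℕ) (ω : Path) : ℝ≥0∞ :=
  if ∀ k ≤ n, 0 ≤ spinePos k ω then renewal Θ (spinePos n ω) / renewal Θ x else 0

/-- `Q` is the law `P⁺_x`: the probability measure whose density with respect to `P*_x` on `F_n` is
`R(X_{ξ_n}) 1_{min_{k ≤ n} X_{ξ_k} ≥ 0} / R(x)`, for every `n`. -/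
structure IsPositiveSpineLaw (Θ : Measure Offspring) (x : ℝ) (Q : Measure Path) : Prop where
  prob : IsProbabilityMeasure Q
  density : ∀ (n : ℕ) (A : Set Path), MeasurableSet[sigmaUpTo n] A →
    Q A = ∫⁻ ω in A, positiveDensity Θ x n ω ∂(spinalLaw Θ x)

theorem measurable_weight : Measurable weight :=
  WithTop.measurable_of_measurable_comp_coe
    (ENNReal.measurable_ofReal.comp (Real.measurable_exp.comp measurable_neg))

theorem measurable_weight_sum : Measurable fun θ : Offspring => ∑' i, weight (θ i) :=
  Measurable.tsum fun i => measurable_weight.comp (measurable_pi_apply i)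

theorem isProbabilityMeasure_spineStep {Θ : Measure Offspring} (hΘ : IsBoundaryCase Θ) :
    IsProbabilityMeasure (spineStep Θ) := by
  constructor
  have hm : ∀ i : ℕ, Measurable fun θ : Offspring => weight (θ i) / ∑' j, weight (θ j) :=
    fun i => (measurable_weight.comp (measurable_pi_apply i)).div measurable_weight_sum
  have h1 : ∀ i : ℕ, Measurable fun θ : Offspring => (θ, i) := fun i => by fun_prop
  simp only [spineStep, Measure.sum_apply _ MeasurableSet.univ,
    Measure.map_apply (h1 _) MeasurableSet.univ, Set.preimage_univ,
    withDensity_apply _ MeasurableSet.univ, Measure.restrict_univ]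
  rw [← lintegral_tsum fun i => (hm i).aemeasurable, sizeBiased,
    lintegral_withDensity_eq_lintegral_mul _ measurable_weight_sum
      (Measurable.tsum hm), ← hΘ.total_weight]
  have hfin : ∀ᵐ θ ∂Θ, ∑' i, weight (θ i) < ∞ :=
    ae_lt_top measurable_weight_sum (by rw [hΘ.total_weight]; exact ENNReal.one_ne_top)
  refine lintegral_congr_ae ?_
  filter_upwards [hfin] with θ hθ
  simp only [Pi.mul_apply, div_eq_mul_inv, ENNReal.tsum_mul_right]
  by_cases h0 : ∑' i, weight (θ i) = 0
  · simp [h0]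
  · rw [ENNReal.mul_inv_cancel h0 hθ.ne, mul_one]

theorem measurable_withTop_add :
    Measurable fun p : WithTop ℝ × WithTop ℝ => p.1 + p.2 := by
  have h : (fun p : WithTop ℝ × WithTop ℝ => p.1 + p.2) = fun p =>
      if p.1 = ⊤ then ⊤ else if p.2 = ⊤ then ⊤ else
        ((p.1.untopD 0 + p.2.untopD 0 : ℝ) : WithTop ℝ) := by
    funext ⟨a, b⟩
    induction a using WithTop.recTopCoe <;> induction b using WithTop.recTopCoe <;> simp
  rw [h]
  refine Measurable.ite (measurable_fst (measurableSet_singleton _)) measurable_const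
    (Measurable.ite (measurable_snd (measurableSet_singleton _)) measurable_const ?_)
  fun_prop

theorem measurableSet_rayVertex_eq (n : ℕ) (u : Vertex) :
    MeasurableSet {r : ℕ → ℕ | u = rayVertex r n} := by
  induction n generalizing u with
  | zero => simp [rayVertex]
  | succ n ih =>
    cases u with
    | nil => simp [rayVertex]
    | cons i u =>
      simp only [rayVertex, List.cons.injEq]
      exact (measurableSet_eq_fun measurable_const (measurable_pi_apply n)).inter (ih u)

theorem measurable_noiseRay : Measurable noiseRay :=
  measurable_pi_lambda _ fun n => by unfold noiseRay; fun_prop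

theorem measurable_noisePosition (x : ℝ) : Measurable (noisePosition x) := by
  refine measurable_pi_lambda _ fun u => ?_
  induction u with
  | nil => exact measurable_const
  | cons i u ih =>
    have ho : Measurable fun ν : Noise => noiseOffspring ν u :=
      Measurable.ite (measurable_noiseRay (measurableSet_rayVertex_eq u.length u))
        (by fun_prop) (by fun_prop)
    exact measurable_withTop_add.comp (ih.prodMk ((measurable_pi_apply i).comp ho))

/-- The law of the spinal branching random walk is a probability measure. -/
theorem isProbabilityMeasure_spinalLaw {Θ : Measure Offspring} (hΘ : IsBoundaryCase Θ) (x : ℝ) :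
    IsProbabilityMeasure (spinalLaw Θ x) := by
  have := hΘ.prob
  have := isProbabilityMeasure_spineStep hΘ
  unfold spinalLaw noiseLaw
  exact Measure.isProbabilityMeasure_map
    ((measurable_noisePosition x).prodMk measurable_noiseRay).aemeasurable

end SpinalBRW

end

/-! Under `P*_x` the spine positions form a random walk `S` started at `x`. By the many-to-one
formula its step is centered, has finite variance and is not a.s. zero. Under `P⁺_x` this walk is
h-transformed by `R`, so everything reduces to one dimension.

Cut `[0, ∞)` into the intervals `[a, a+1)`. As `f` is non-increasing, the expectation is at most `∑ₐ
f(a) G⁺(x, a)`, where `G⁺(x, a)` is the expected number of visits to `[a, a+1)`. As `R` is monotone,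
`G⁺(x, a)` is at most `R(a+1)/R(x)` times the Green mass of `[a, a+1]` for the walk killed below
`0`. Split each killed path at the first time of its minimum. The part before is a strict descending
ladder epoch with height in `[-x, a+1-x]`. The part after stays above its start, so reversing time
makes its end a weak ascending ladder point; these have bounded expected number in any unit interval
(`exists_ladder_bound`). Hence the Green mass is at most `C Z`, where `Z` is the expected number of
descending ladder heights in `[-x, a+1-x]`, and `Z ≤ min(R(x), K(a+2))` (`exists_green_bound`,
`exists_potential_bound`). This gives `E⁺_x[∑ f] ≤ C ∑ₐ f(a) R(a+1) min(1, K(a+2)/R(x))`. `R` grows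
at most linearly, so `∫ y f(y) dy < ∞` makes `∑ₐ f(a) R(a+1)` finite: this is the finiteness claim.
As `R(x) → ∞`, dominated convergence gives the limit.

Existence of `P⁺_x` needs `R` to be harmonic for the killed walk. Duality gives `E R(y+X) = R(y) -
(1-q)` for `y ≥ 0`, with `q` the probability that the walk is nonnegative at some positive time.
Both `q = 1` and `R(x) → ∞` follow by integrating this identity in `y` and using the convexity of
the primitive of `R`. The Ionescu-Tulcea theorem then builds the spine noise, and the noise off the
spine is left unchanged. -/

noncomputable section

namespace SpinalBRW

/-! ### Walks driven by i.i.d. sequences: Markov property and time reversal -/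

section Walk

variable {E : Type*}

/-- The sums `g (ω 0) + ⋯ + g (ω (n - 1))`. -/
def walk (g : E → ℝ) (n : ℕ) (ω : ℕ → E) : ℝ := ∑ i ∈ Finset.range n, g (ω i)

/-- The sequence `ω'`, preceded by the first `n` terms of `ω`. -/
def splice (n : ℕ) (ω ω' : ℕ → E) : ℕ → E := fun i => if i < n then ω i else ω' (i - n)

/-- The permutation of `ℕ` that reverses the order of the first `n` numbers. -/
def reversePerm (n : ℕ) : Equiv.Perm ℕ where
  toFun i := if i < n then n - 1 - i else i
  invFun i := if i < n then n - 1 - i else i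
  left_inv i := by grind
  right_inv i := by grind

/-- The sequence `ω` with its first `n` terms in reversed order. -/
def reversePrefix (n : ℕ) (ω : ℕ → E) : ℕ → E := fun i => ω (reversePerm n i)

@[simp] theorem walk_zero (g : E → ℝ) (ω : ℕ → E) : walk g 0 ω = 0 := by simp [walk]

theorem walk_succ (g : E → ℝ) (n : ℕ) (ω : ℕ → E) : walk g (n + 1) ω = walk g n ω + g (ω n) :=
  Finset.sum_range_succ _ _

theorem walk_neg (g : E → ℝ) (n : ℕ) (ω : ℕ → E) :
    walk (fun e => -g e) n ω = -walk g n ω := by simp [walk]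

theorem walk_congr (g : E → ℝ) {n : ℕ} {ω ω' : ℕ → E} (h : ∀ i < n, ω i = ω' i) :
    walk g n ω = walk g n ω' :=
  Finset.sum_congr rfl fun i hi => by rw [h i (Finset.mem_range.1 hi)]

theorem walk_splice_of_le (g : E → ℝ) {n j : ℕ} (h : j ≤ n) (ω ω' : ℕ → E) :
    walk g j (splice n ω ω') = walk g j ω :=
  walk_congr g fun _ hi => if_pos (hi.trans_le h)

theorem walk_splice_add (g : E → ℝ) (n j : ℕ) (ω ω' : ℕ → E) :
    walk g (n + j) (splice n ω ω') = walk g n ω + walk g j ω' := by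
  induction j with
  | zero => simp [walk_splice_of_le]
  | succ j ih => rw [← add_assoc, walk_succ, ih, walk_succ]; simp [splice, add_assoc]

theorem walk_reversePrefix (g : E → ℝ) {n j : ℕ} (h : j ≤ n) (ω : ℕ → E) :
    walk g j (reversePrefix n ω) = walk g n ω - walk g (n - j) ω := by
  induction j with
  | zero => simp
  | succ j ih =>
    have h1 : n - j = (n - (j + 1)) + 1 := by omega
    rw [walk_succ, ih (by omega), h1, walk_succ]
    have : reversePrefix n ω j = ω (n - (j + 1)) := by
      simp only [reversePrefix, reversePerm, Equiv.coe_fn_mk, if_pos (show j < n by omega)]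
      congr 1; omega
    rw [this]; ring

variable [MeasurableSpace E]

@[fun_prop] theorem measurable_walk {g : E → ℝ} (hg : Measurable g) (n : ℕ) :
    Measurable (walk g n) := by
  unfold walk; fun_prop

theorem measurable_splice (n : ℕ) :
    Measurable fun p : (ℕ → E) × (ℕ → E) => splice n p.1 p.2 := by
  refine measurable_pi_lambda _ fun i => ?_
  by_cases h : i < n <;> simp only [splice, h, if_true, if_false] <;> fun_prop

theorem measurable_reversePrefix (n : ℕ) :
    Measurable (reversePrefix n : (ℕ → E) → ℕ → E) := by
  unfold reversePrefix; fun_prop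

variable (m : Measure E) [IsProbabilityMeasure m]

/-- The law of an i.i.d. sequence with common law `m`. -/
abbrev iidLaw : Measure (ℕ → E) := Measure.infinitePi fun _ : ℕ => m

/-- Markov property at time `n`: continuing with an independent copy does not change the law. On a
cylinder, the coordinates below `n` and the shifted coordinates from `n` on give two independent
cylinders. -/
theorem map_splice (n : ℕ) :
    ((iidLaw m).prod (iidLaw m)).map (fun p => splice n p.1 p.2) = iidLaw m := by
  refine Measure.eq_infinitePi _ fun s t ht => ?_
  rw [Measure.map_apply (measurable_splice n) (.pi s.countable_toSet fun i _ => ht i)]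
  have : (fun p : (ℕ → E) × (ℕ → E) => splice n p.1 p.2) ⁻¹' (s : Set ℕ).pi t =
      ((s.filter (· < n) : Finset ℕ) : Set ℕ).pi t ×ˢ
      (((s.filter (¬ · < n)).image (· - n) : Finset ℕ) : Set ℕ).pi (fun i => t (i + n)) := by
    ext ⟨ω, ω'⟩
    simp only [Set.mem_preimage, Set.mem_pi, Set.mem_prod, Finset.coe_filter, Finset.coe_image,
      splice, Set.mem_ofPred_eq, Finset.mem_coe, Set.mem_image]
    constructor
    · refine fun h => ⟨fun i hi => by simpa [hi.2] using h i hi.1, ?_⟩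
      rintro _ ⟨i, ⟨hi, hn⟩, rfl⟩
      have := h i hi
      rw [if_neg hn] at this
      rwa [Nat.sub_add_cancel (not_lt.1 hn)]
    · rintro ⟨h1, h2⟩ i hi
      by_cases hn : i < n
      · simpa [hn] using h1 i ⟨hi, hn⟩
      · have := h2 (i - n) ⟨i, ⟨hi, hn⟩, rfl⟩
        rw [Nat.sub_add_cancel (not_lt.1 hn)] at this
        simpa [hn] using this
  rw [this, Measure.prod_prod, Measure.infinitePi_pi _ fun i _ => ht i,
    Measure.infinitePi_pi _ fun i _ => ht _, Finset.prod_image,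
    ← Finset.prod_filter_mul_prod_filter_not s (· < n)]
  · congr 1
    refine Finset.prod_congr rfl fun i hi => ?_
    rw [Nat.sub_add_cancel (not_lt.1 (Finset.mem_filter.1 hi).2)]
  · intro i hi j hj hij
    simp only [Finset.coe_filter, Set.mem_ofPred_eq, not_lt] at hi hj hij
    omega

theorem lintegral_splice (n : ℕ) {F : (ℕ → E) → ℝ≥0∞} (hF : Measurable F) :
    ∫⁻ ω, F ω ∂iidLaw m = ∫⁻ ω, ∫⁻ ω', F (splice n ω ω') ∂iidLaw m ∂iidLaw m := by
  conv_lhs => rw [← map_splice m n]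
  rw [lintegral_map hF (measurable_splice n)]
  exact lintegral_prod _ (hF.comp (measurable_splice n)).aemeasurable

theorem map_reversePrefix (n : ℕ) : (iidLaw m).map (reversePrefix n) = iidLaw m := by
  have h := Measure.infinitePi_map_piCongrLeft (fun _ : ℕ => m) (reversePerm n).symm
  convert h using 2
  funext ω i
  simp [reversePrefix, MeasurableEquiv.coe_piCongrLeft, Equiv.piCongrLeft_apply]

theorem iidLaw_reversePrefix (n : ℕ) {s : Set (ℕ → E)} (hs : MeasurableSet s) :
    iidLaw m (reversePrefix n ⁻¹' s) = iidLaw m s := by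
  rw [← Measure.map_apply (measurable_reversePrefix n) hs, map_reversePrefix]

end Walk

/-! ### Ladder heights and the Green function of the killed walk -/

section Ladder

set_option linter.unusedSectionVars false

variable {E : Type*} [MeasurableSpace E] (m : Measure E) {g : E → ℝ}

theorem exists_pos_measure_ge (hpos : 0 < m {e | 0 < g e}) :
    ∃ ε : ℝ, 0 < ε ∧ 0 < m {e | ε ≤ g e} := by
  by_contra! h
  have : {e | 0 < g e} ⊆ ⋃ n : ℕ, {e | 1 / ((n : ℝ) + 1) ≤ g e} := by
    intro e he
    obtain ⟨n, hn⟩ := exists_nat_one_div_lt (show (0 : ℝ) < g e from he)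
    exact Set.mem_iUnion.2 ⟨n, hn.le⟩
  refine hpos.ne' (measure_mono_null this (measure_iUnion_null fun n => ?_))
  exact le_antisymm (h _ (by positivity)) bot_le

/-- The event that the walk is at a strictly descending ladder epoch at time `n`. -/
def strictDescent (g : E → ℝ) (n : ℕ) : Set (ℕ → E) :=
  {ω | ∀ k < n, walk g n ω < walk g k ω}

/-- The renewal function of the strictly descending ladder heights of the walk. -/
def descRenewal (m : Measure E) (g : E → ℝ) (x : ℝ) : ℝ≥0∞ :=
  ∑' n : ℕ, iidLaw m {ω | -x ≤ walk g n ω ∧ ω ∈ strictDescent g n}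

theorem walk_le_zero_of_mem_strictDescent {n : ℕ} {ω : ℕ → E} (h : ω ∈ strictDescent g n) :
    walk g n ω ≤ 0 := by
  rcases n.eq_zero_or_pos with rfl | hn
  · simp
  · simpa using (h 0 hn).le

theorem descRenewal_mono : Monotone (descRenewal m g) := by
  refine fun x y hxy => ENNReal.tsum_le_tsum fun n => measure_mono ?_
  rintro ω ⟨h1, h2⟩
  exact ⟨by linarith, h2⟩

theorem descRenewal_of_neg {x : ℝ} (hx : x < 0) : descRenewal m g x = 0 := by
  refine ENNReal.tsum_eq_zero.2 fun n => ?_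
  convert measure_empty (μ := iidLaw m)
  refine Set.eq_empty_of_forall_notMem ?_
  rintro ω ⟨h1, h2⟩
  linarith [walk_le_zero_of_mem_strictDescent h2]

variable [IsProbabilityMeasure m]

/-- The renewal measure of the weakly ascending ladder heights gives bounded mass to intervals of
length one. -/
theorem exists_ladder_bound (hg : Measurable g) (hpos : 0 < m {e | 0 < g e}) :
    ∃ C : ℝ≥0∞, C ≠ ∞ ∧ ∀ b : ℝ, ∑' n : ℕ, iidLaw m {ω | b ≤ walk g n ω ∧ walk g n ω ≤ b + 1 ∧
      ∀ j ≤ n, walk g j ω ≤ walk g n ω} ≤ C := by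
  obtain ⟨ε, hε, hδ⟩ := exists_pos_measure_ge m hpos
  -- With `k ε > 1`, a run of `k` steps of size at least `ε`, of probability `δ ^ k`, jumps over the
  -- whole interval.
  obtain ⟨k, hk⟩ := exists_nat_gt (1 / ε)
  rw [div_lt_iff₀ hε] at hk
  set δ := m {e | ε ≤ g e}
  have hδk : δ ^ k ≠ 0 := pow_ne_zero _ hδ.ne'
  have hδt : δ ^ k ≠ ∞ := ENNReal.pow_ne_top (measure_ne_top _ _)
  refine ⟨(k : ℝ≥0∞) / δ ^ k, ENNReal.div_ne_top (by simp) hδk, fun b => ?_⟩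
  set A : ℕ → Set (ℕ → E) := fun n => {ω | b ≤ walk g n ω ∧ walk g n ω ≤ b + 1 ∧
      ∀ j ≤ n, walk g j ω ≤ walk g n ω}
  set B : ℕ → Set (ℕ → E) := fun n => A n ∩ {ω | b + 1 < walk g (n + k) ω}
  have hA : ∀ n, MeasurableSet (A n) := fun n => by
    simp only [A, measurableSet_setOfPred]
    fun_prop
  have hB : ∀ n, MeasurableSet (B n) := fun n =>
    (hA n).inter (measurableSet_lt measurable_const (measurable_walk hg _))
  have hstep : ∀ n, δ ^ k * iidLaw m (A n) ≤ iidLaw m (B n) := by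
    intro n
    set D : Set (ℕ → E) := ((Finset.range k : Finset ℕ) : Set ℕ).pi fun _ => {e | ε ≤ g e}
    have hD : iidLaw m D = δ ^ k := by
      rw [Measure.infinitePi_pi _ fun _ _ => measurableSet_le measurable_const hg]
      simp [δ]
    have hDm : MeasurableSet D :=
      .pi (Finset.countable_toSet _) fun _ _ => measurableSet_le measurable_const hg
    have hmem : ∀ ω ω', ω ∈ A n → ω' ∈ D → splice n ω ω' ∈ B n := by
      intro ω ω' hω hω'
      have h1 : (k : ℝ) * ε ≤ walk g k ω' := by
        have := Finset.card_nsmul_le_sum (Finset.range k) (fun i => g (ω' i)) ε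
          fun i hi => hω' i (by exact_mod_cast hi)
        simpa [walk] using this
      refine ⟨⟨?_, ?_, fun j hj => ?_⟩, ?_⟩
      · rw [walk_splice_of_le g le_rfl]; exact hω.1
      · rw [walk_splice_of_le g le_rfl]; exact hω.2.1
      · rw [walk_splice_of_le g le_rfl, walk_splice_of_le g hj]; exact hω.2.2 j hj
      · change b + 1 < walk g (n + k) _
        rw [walk_splice_add]
        have := hω.1
        linarith
    rw [← lintegral_indicator_one (hB n), lintegral_splice m n (measurable_one.indicator (hB n)),
      ← lintegral_indicator_one (hA n), ← lintegral_const_mul _ (measurable_one.indicator (hA n))]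
    refine lintegral_mono fun ω => ?_
    by_cases hω : ω ∈ A n
    · rw [Set.indicator_of_mem hω, Pi.one_apply, mul_one, ← hD, ← lintegral_indicator_one hDm]
      refine lintegral_mono fun ω' => ?_
      by_cases hω' : ω' ∈ D
      · simp [hω', hmem ω ω' hω hω']
      · simp [hω']
    · simp [hω]
  -- If `n₀` is the first index with `B n₀`, the walk is above `b + 1` at time `n₀ + k`, so no later
  -- time can be a running maximum inside `[b, b + 1]`. Only `k` indices remain.
  have hcount : ∀ ω, ∑' n, (B n).indicator (1 : (ℕ → E) → ℝ≥0∞) ω ≤ k := by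
    intro ω
    by_cases hex : ∃ n, ω ∈ B n
    · classical
      have hsupp : ∀ n, n ∉ Finset.Ico (Nat.find hex) (Nat.find hex + k) →
          (B n).indicator (1 : (ℕ → E) → ℝ≥0∞) ω = 0 := by
        intro n hn
        refine Set.indicator_of_notMem (fun hmem => hn ?_) _
        refine Finset.mem_Ico.2 ⟨Nat.find_min' hex hmem, ?_⟩
        by_contra! hlt
        have h1 := (Nat.find_spec hex).2
        have h2 := hmem.1.2.2 _ hlt
        have h3 := hmem.1.2.1
        simp only [Set.mem_ofPred_eq] at h1
        linarith
      rw [tsum_eq_sum hsupp]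
      refine (Finset.sum_le_card_nsmul _ _ 1 fun n _ => ?_).trans (by simp)
      by_cases hn : ω ∈ B n <;> simp [hn]
    · push Not at hex
      simp [hex]
  rw [ENNReal.le_div_iff_mul_le (.inl hδk) (.inl hδt), mul_comm, ← ENNReal.tsum_mul_left]
  calc ∑' n, δ ^ k * iidLaw m (A n) ≤ ∑' n, iidLaw m (B n) := ENNReal.tsum_le_tsum hstep
    _ = ∫⁻ ω, ∑' n, (B n).indicator 1 ω ∂iidLaw m := by
      rw [lintegral_tsum fun n => (measurable_one.indicator (hB n)).aemeasurable]
      simp [hB]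
    _ ≤ ∫⁻ _, k ∂iidLaw m := lintegral_mono hcount
    _ = k := by simp

theorem measurableSet_strictDescent (hg : Measurable g) (n : ℕ) :
    MeasurableSet (strictDescent g n) := by
  simp only [strictDescent, measurableSet_setOfPred]; fun_prop

/-- Strict descending ladder epochs of `g` are weak ascending ones of `-g`. An interval of length
`N` is covered by unit intervals; the extra `1` serves the degenerate case `N = 0`. -/
theorem exists_strictDescent_bound (hg : Measurable g) (hneg : 0 < m {e | g e < 0}) :
    ∃ C : ℝ≥0∞, C ≠ ∞ ∧ ∀ (x : ℝ) (N : ℕ), ∑' n : ℕ, iidLaw m {ω | -x ≤ walk g n ω ∧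
      walk g n ω ≤ -x + N ∧ ω ∈ strictDescent g n} ≤ C * (N + 1) := by
  obtain ⟨C, hC, h⟩ := exists_ladder_bound m (g := fun e => -g e) hg.neg (by simpa using hneg)
  have hunit : ∀ x : ℝ, ∑' n : ℕ, iidLaw m {ω | -x ≤ walk g n ω ∧
      walk g n ω ≤ -x + 1 ∧ ω ∈ strictDescent g n} ≤ C := by
    refine fun x => (ENNReal.tsum_le_tsum fun n => measure_mono ?_).trans (h (x - 1))
    rintro ω ⟨h1, h2, h3⟩
    simp only [walk_neg, Set.mem_ofPred_eq]
    refine ⟨by linarith, by linarith, fun j hj => ?_⟩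
    rcases hj.lt_or_eq with hj | rfl
    · linarith [h3 j hj]
    · exact le_rfl
  refine ⟨C, hC, fun x N => ?_⟩
  induction N with
  | zero =>
    refine (ENNReal.tsum_le_tsum fun n => measure_mono ?_).trans ((hunit x).trans (by simp))
    rintro ω ⟨h1, h2, h3⟩
    refine ⟨h1, ?_, h3⟩
    simp only [Nat.cast_zero] at h2
    linarith
  | succ N ih =>
    have : C * ((N + 1 : ℕ) + 1) = C * (N + 1) + C := by push_cast; ring
    rw [this]
    refine le_trans ?_ (add_le_add ih (hunit (x - N)))
    rw [← ENNReal.tsum_add]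
    refine ENNReal.tsum_le_tsum fun n => (measure_mono ?_).trans (measure_union_le _ _)
    rintro ω ⟨h1, h2, h3⟩
    push_cast at h2
    by_cases hN : walk g n ω ≤ -x + N
    · exact .inl ⟨h1, hN, h3⟩
    · exact .inr ⟨by linarith, by linarith, h3⟩

theorem exists_descRenewal_bound (hg : Measurable g) (hneg : 0 < m {e | g e < 0}) :
    ∃ C : ℝ≥0∞, C ≠ ∞ ∧ ∀ N : ℕ, descRenewal m g N ≤ C * (N + 1) := by
  obtain ⟨C, hC, h⟩ := exists_strictDescent_bound m hg hneg
  refine ⟨C, hC, fun N => (ENNReal.tsum_le_tsum fun n => measure_mono ?_).trans (h N N)⟩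
  rintro ω ⟨h1, h2⟩
  refine ⟨h1, ?_, h2⟩
  simpa using walk_le_zero_of_mem_strictDescent h2

theorem one_le_descRenewal {x : ℝ} (hx : 0 ≤ x) : 1 ≤ descRenewal m g x := by
  refine le_trans ?_ (ENNReal.le_tsum 0)
  simp [strictDescent, hx]

theorem descRenewal_ne_top (hg : Measurable g) (hneg : 0 < m {e | g e < 0}) (x : ℝ) :
    descRenewal m g x ≠ ∞ := by
  obtain ⟨C, hC, h⟩ := exists_descRenewal_bound m hg hneg
  obtain ⟨N, hN⟩ := exists_nat_ge x
  refine ne_top_of_le_ne_top ?_ ((descRenewal_mono m hN).trans (h N))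
  exact ENNReal.mul_ne_top hC (by simp)

/-- Taking the first minimizer gives strict inequality before it, as strict ladder epochs require,
and weak inequality after it. -/
theorem exists_first_min (s : ℕ → ℝ) (k : ℕ) :
    ∃ i ≤ k, (∀ j ≤ k, s i ≤ s j) ∧ ∀ j < i, s i < s j := by
  classical
  have hex : ∃ i, i ≤ k ∧ ∀ j ≤ k, s i ≤ s j := by
    obtain ⟨i, hi, h⟩ := Finset.exists_min_image (Finset.range (k + 1)) s ⟨0, by simp⟩
    refine ⟨i, by simpa [Nat.lt_succ_iff] using hi, fun j hj => h j ?_⟩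
    simpa [Nat.lt_succ_iff] using hj
  refine ⟨Nat.find hex, (Nat.find_spec hex).1, (Nat.find_spec hex).2, fun j hj => ?_⟩
  by_contra! hle
  exact Nat.find_min hex hj ⟨hj.le.trans (Nat.find_spec hex).1,
    fun i hi => hle.trans ((Nat.find_spec hex).2 i hi)⟩

/-- Reversing the first `n` steps turns staying nonnegative up to time `n` into being at a weak
running maximum at time `n`. -/
theorem exists_nonneg_walk_bound (hg : Measurable g) (hpos : 0 < m {e | 0 < g e}) :
    ∃ C : ℝ≥0∞, C ≠ ∞ ∧ ∀ b : ℝ, ∑' n : ℕ, iidLaw m {ω | b ≤ walk g n ω ∧ walk g n ω ≤ b + 1 ∧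
      ∀ j ≤ n, 0 ≤ walk g j ω} ≤ C := by
  obtain ⟨C, hC, h⟩ := exists_ladder_bound m hg hpos
  refine ⟨C, hC, fun b => (ENNReal.tsum_le_tsum fun n => ?_).trans (h b)⟩
  rw [← iidLaw_reversePrefix m n]
  · refine measure_mono ?_
    rintro ω ⟨h1, h2, h3⟩
    simp only [walk_reversePrefix g le_rfl, Nat.sub_self, walk_zero, sub_zero] at h1 h2
    refine ⟨h1, h2, fun j hj => ?_⟩
    have := h3 (n - j) (Nat.sub_le _ _)
    rw [walk_reversePrefix g (Nat.sub_le _ _), Nat.sub_sub_self hj] at this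
    linarith
  · simp only [measurableSet_setOfPred]; fun_prop

/-- The Green function of the walk killed when it becomes negative, bounded through the position
of the overall minimum. -/
theorem exists_green_bound (hg : Measurable g) (hpos : 0 < m {e | 0 < g e}) :
    ∃ C : ℝ≥0∞, C ≠ ∞ ∧ ∀ x a : ℝ, ∑' k : ℕ, iidLaw m {ω | a ≤ x + walk g k ω ∧
      x + walk g k ω ≤ a + 1 ∧ ∀ j ≤ k, 0 ≤ x + walk g j ω} ≤
      C * ∑' n : ℕ, iidLaw m {ω | -x ≤ walk g n ω ∧ walk g n ω ≤ a + 1 - x ∧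
        ω ∈ strictDescent g n} := by
  obtain ⟨C, hC, h⟩ := exists_nonneg_walk_bound m hg hpos
  refine ⟨C, hC, fun x a => ?_⟩
  set L : ℕ → Set (ℕ → E) := fun n => {ω | -x ≤ walk g n ω ∧ walk g n ω ≤ a + 1 - x ∧
        ω ∈ strictDescent g n}
  set V : ℝ → ℕ → Set (ℕ → E) := fun b l => {ω | b ≤ walk g l ω ∧ walk g l ω ≤ b + 1 ∧
      ∀ j ≤ l, 0 ≤ walk g j ω}
  -- `H i l`: the first minimum is at time `i`, and the target interval is occupied `l` steps later.
  -- `L` and `V` are its pre-minimum and post-minimum parts.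
  set H : ℕ → ℕ → Set (ℕ → E) := fun i l => {ω | -x ≤ walk g i ω ∧ ω ∈ strictDescent g i ∧
    a ≤ x + walk g (i + l) ω ∧ x + walk g (i + l) ω ≤ a + 1 ∧
    ∀ j ≤ l, walk g i ω ≤ walk g (i + j) ω}
  have hL : ∀ n, MeasurableSet (L n) := fun n =>
    (measurableSet_le measurable_const (measurable_walk hg n)).inter
      ((measurableSet_le (measurable_walk hg n) measurable_const).inter
        (measurableSet_strictDescent hg n))
  have hV : ∀ b l, MeasurableSet (V b l) := fun b l => by
    simp only [V, measurableSet_setOfPred]; fun_prop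
  have hH : ∀ i l, MeasurableSet (H i l) := fun i l => by
    simp only [H, strictDescent, Set.mem_ofPred_eq, measurableSet_setOfPred]; fun_prop
  have hsum : ∀ i, ∑' l, iidLaw m (H i l) ≤ C * iidLaw m (L i) := by
    intro i
    calc ∑' l, iidLaw m (H i l)
        = ∫⁻ ω, ∑' l, (H i l).indicator (1 : (ℕ → E) → ℝ≥0∞) ω ∂iidLaw m := by
          rw [lintegral_tsum fun l => (measurable_one.indicator (hH i l)).aemeasurable]
          simp [hH]
      _ = ∫⁻ ω, ∫⁻ ω', ∑' l, (H i l).indicator (1 : (ℕ → E) → ℝ≥0∞) (splice i ω ω')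
            ∂iidLaw m ∂iidLaw m :=
          lintegral_splice m i (Measurable.tsum fun l => measurable_one.indicator (hH i l))
      _ ≤ ∫⁻ ω, C * (L i).indicator (1 : (ℕ → E) → ℝ≥0∞) ω ∂iidLaw m := by
          refine lintegral_mono fun ω => ?_
          -- The endpoint, at most `a + 1`, is not below the minimum; this gives the upper bound on
          -- the ladder height in `L`.
          have hsub : ∀ ω' l, splice i ω ω' ∈ H i l →
              ω ∈ L i ∧ ω' ∈ V (a - x - walk g i ω) l := by
            rintro ω' l ⟨h1, h2, h3, h4, h5⟩
            simp only [walk_splice_add] at h3 h4 h5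
            simp only [walk_splice_of_le g le_rfl] at h1 h5
            have h6 := h5 l le_rfl
            refine ⟨⟨h1, by linarith, fun k hk => ?_⟩, by linarith, by linarith,
              fun j hj => by linarith [h5 j hj]⟩
            have := h2 k hk
            rwa [walk_splice_of_le g le_rfl, walk_splice_of_le g hk.le] at this
          by_cases hω : ω ∈ L i
          · rw [Set.indicator_of_mem hω, Pi.one_apply, mul_one]
            refine le_trans ?_ (h (a - x - walk g i ω))
            calc _ ≤ ∫⁻ ω', ∑' l, (V (a - x - walk g i ω) l).indicator
                    (1 : (ℕ → E) → ℝ≥0∞) ω' ∂iidLaw m := by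
                  refine lintegral_mono fun ω' => ENNReal.tsum_le_tsum fun l => ?_
                  by_cases hs : splice i ω ω' ∈ H i l
                  · simp [(hsub ω' l hs).2, hs]
                  · simp [hs]
              _ = _ := by
                  rw [lintegral_tsum fun l => (measurable_one.indicator (hV _ l)).aemeasurable]
                  simp only [lintegral_indicator_one, hV]
                  rfl
          · have : ∀ ω' l, splice i ω ω' ∉ H i l := fun ω' l hs => hω (hsub ω' l hs).1
            simp [this]
      _ = C * iidLaw m (L i) := by
          rw [lintegral_const_mul _ (measurable_one.indicator (hL i)),
            lintegral_indicator_one (hL i)]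
  rw [← ENNReal.tsum_mul_left]
  refine le_trans ?_ (ENNReal.tsum_le_tsum hsum)
  calc _ ≤ ∑' k, ∑' i, (if i ≤ k then iidLaw m (H i (k - i)) else 0) := by
        refine ENNReal.tsum_le_tsum fun k => ?_
        refine le_trans (measure_mono ?_) (measure_iUnion_le
          (fun i => if i ≤ k then H i (k - i) else ∅)) |>.trans (ENNReal.tsum_le_tsum fun i => ?_)
        · rintro ω ⟨h1, h2, h3⟩
          obtain ⟨i, hi, h4, h5⟩ := exists_first_min (fun j => walk g j ω) k
          refine Set.mem_iUnion.2 ⟨i, ?_⟩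
          rw [if_pos hi]
          refine ⟨by linarith [h3 i hi], h5, ?_, ?_, fun j hj => h4 _ (by omega)⟩
          · rwa [Nat.add_sub_cancel' hi]
          · rwa [Nat.add_sub_cancel' hi]
        · split_ifs <;> simp
    _ = ∑' i, ∑' k, (if i ≤ k then iidLaw m (H i (k - i)) else 0) := ENNReal.tsum_comm
    _ = ∑' i, ∑' l, iidLaw m (H i l) := by
        refine tsum_congr fun i => ?_
        rw [← ENNReal.summable.sum_add_tsum_nat_add' (k := i), Finset.sum_eq_zero, zero_add]
        · simp
        · intro k hk
          simp [Finset.mem_range.1 hk]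

end Ladder

/-! ### Duality and the renewal equation up to a constant defect -/

section Renewal

variable {E : Type*} [MeasurableSpace E] (m : Measure E) [IsProbabilityMeasure m] {g : E → ℝ}

/-- When `F` looks only at the first `n` coordinates, an independent step can be identified with
coordinate `n`. -/
theorem lintegral_next (n : ℕ) {F : (ℕ → E) → E → ℝ≥0∞} (hF : Measurable (Function.uncurry F))
    (hdep : ∀ ω ω' e, (∀ i < n, ω i = ω' i) → F ω e = F ω' e) :
    ∫⁻ ω, ∫⁻ e, F ω e ∂m ∂iidLaw m = ∫⁻ ω, F ω (ω n) ∂iidLaw m := by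
  have hm : Measurable fun ω : ℕ → E => F ω (ω n) :=
    hF.comp (measurable_id.prodMk (measurable_pi_apply n))
  rw [lintegral_splice m n hm]
  refine lintegral_congr fun ω => ?_
  have h0 : (iidLaw m).map (fun ω' => ω' 0) = m := Measure.infinitePi_map_eval _ 0
  conv_lhs => rw [← h0]
  have hFω : Measurable (F ω) := hF.comp (measurable_const.prodMk measurable_id)
  rw [lintegral_map hFω (measurable_pi_apply 0)]
  refine lintegral_congr fun ω' => ?_
  simp only [splice, lt_irrefl, if_false, Nat.sub_self]
  exact hdep _ _ _ fun i hi => (if_pos hi).symm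

/-- The event that the walk is negative at the times `1, …, n`. -/
def negativeUpTo (g : E → ℝ) (n : ℕ) : Set (ℕ → E) :=
  {ω | ∀ j, 1 ≤ j → j ≤ n → walk g j ω < 0}

theorem measurableSet_negativeUpTo (hg : Measurable g) (n : ℕ) :
    MeasurableSet (negativeUpTo g n) := by
  simp only [negativeUpTo, measurableSet_setOfPred]; fun_prop

/-- Duality: under time reversal, a strict minimum at time `n` becomes a walk that is negative at
the times `1, …, n`. -/
theorem descRenewal_eq_tsum_negativeUpTo (hg : Measurable g) (x : ℝ) :
    descRenewal m g x = ∑' n : ℕ, iidLaw m {ω | -x ≤ walk g n ω ∧ ω ∈ negativeUpTo g n} := by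
  refine tsum_congr fun n => ?_
  rw [← iidLaw_reversePrefix m n]
  · congr 1
    ext ω
    simp only [Set.mem_preimage, Set.mem_ofPred_eq, strictDescent, negativeUpTo,
      walk_reversePrefix g le_rfl, Nat.sub_self, walk_zero, sub_zero]
    refine and_congr_right fun _ => ⟨fun h j h1 h2 => ?_, fun h k hk => ?_⟩
    · have := h (n - j) (by omega)
      rw [walk_reversePrefix g (Nat.sub_le _ _), Nat.sub_sub_self h2] at this
      linarith
    · rw [walk_reversePrefix g hk.le]
      linarith [h (n - k) (by omega) (by omega)]
  · exact (measurableSet_le measurable_const (measurable_walk hg n)).inter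
      (measurableSet_strictDescent hg n)

/-- In the dual form the averaged step can be appended at the end of the walk, as step `n + 1`,
where the event `negativeUpTo g n` does not see it. -/
theorem lintegral_descRenewal_eq_tsum (hg : Measurable g) (y : ℝ) :
    ∫⁻ e, descRenewal m g (y + g e) ∂m =
      ∑' n : ℕ, iidLaw m {ω | -y ≤ walk g (n + 1) ω ∧ ω ∈ negativeUpTo g n} := by
  have hS : ∀ n, MeasurableSet {p : E × (ℕ → E) | -(y + g p.1) ≤ walk g n p.2 ∧
      p.2 ∈ negativeUpTo g n} := fun n =>
    (measurableSet_le (by fun_prop) ((measurable_walk hg n).comp measurable_snd)).inter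
      (measurable_snd (measurableSet_negativeUpTo hg n))
  simp_rw [descRenewal_eq_tsum_negativeUpTo m hg]
  rw [lintegral_tsum (f := fun n e => iidLaw m {ω | -(y + g e) ≤ walk g n ω ∧
    ω ∈ negativeUpTo g n}) fun n => (measurable_measure_prodMk_left (hS n)).aemeasurable]
  refine tsum_congr fun n => ?_
  have h1 := lintegral_next m n (F := fun ω e => Set.indicator {p : E × (ℕ → E) |
    -(y + g p.1) ≤ walk g n p.2 ∧ p.2 ∈ negativeUpTo g n} 1 (e, ω))
    ((measurable_one.indicator (hS n)).comp measurable_swap) (fun ω ω' e h => by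
      have hw : ∀ j ≤ n, walk g j ω = walk g j ω' := fun j hj =>
        walk_congr g fun i hi => h i (hi.trans_le hj)
      simp only [Set.indicator, Set.mem_ofPred_eq, negativeUpTo, hw n le_rfl]
      congr 2
      refine propext (forall_congr' fun j => forall_congr' fun _ => forall_congr' fun hj => ?_)
      rw [hw j hj])
  rw [lintegral_lintegral_swap] at h1
  · have hm : MeasurableSet {ω | -y ≤ walk g (n + 1) ω ∧ ω ∈ negativeUpTo g n} :=
      (measurableSet_le measurable_const (measurable_walk hg _)).inter
        (measurableSet_negativeUpTo hg n)
    rw [← lintegral_indicator_one hm]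
    refine Eq.trans (lintegral_congr fun e => ?_) (h1.trans (lintegral_congr fun ω => ?_))
    · rw [← lintegral_indicator_one]
      · rfl
      · exact measurable_prodMk_left (hS n)
    · simp only [Set.indicator, Set.mem_ofPred_eq, walk_succ]
      congr 2
      refine propext ?_
      rw [walk_succ]
      constructor <;> intro h <;> linarith
  · exact ((measurable_one.indicator (hS n)).comp measurable_swap).aemeasurable

/-- The renewal function is harmonic up to the probability that the walk stays negative. -/
theorem exists_lintegral_descRenewal (hg : Measurable g) :
    ∃ q : ℝ≥0∞, q ≤ 1 ∧ ∀ y : ℝ, 0 ≤ y →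
      ∫⁻ e, descRenewal m g (y + g e) ∂m + 1 = descRenewal m g y + q := by
  -- `U n`: the first positive time at which the walk is nonnegative is `n + 1`. These events are
  -- disjoint, and `q` is their total probability.
  set U : ℕ → Set (ℕ → E) := fun n => {ω | 0 ≤ walk g (n + 1) ω ∧ ω ∈ negativeUpTo g n}
  have hU : ∀ n, MeasurableSet (U n) := fun n =>
    (measurableSet_le measurable_const (measurable_walk hg _)).inter
      (measurableSet_negativeUpTo hg n)
  refine ⟨∑' n, iidLaw m (U n), ?_, fun y hy => ?_⟩
  · rw [← measure_iUnion _ hU]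
    · exact prob_le_one
    · have : ∀ i j ω, i < j → ω ∈ U i → ω ∈ U j → False := fun i j ω hij hi hj =>
        (hj.2 (i + 1) (by omega) (by omega)).not_ge hi.1
      intro i j hij
      refine Set.disjoint_left.2 fun ω hi hj => ?_
      rcases hij.lt_or_gt with h | h
      · exact this i j ω h hi hj
      · exact this j i ω h hj hi
  · rw [lintegral_descRenewal_eq_tsum m hg, descRenewal_eq_tsum_negativeUpTo m hg,
      tsum_eq_zero_add' (f := fun n => iidLaw m {ω | -y ≤ walk g n ω ∧ ω ∈ negativeUpTo g n})
        ENNReal.summable]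
    have h0 : iidLaw m {ω | -y ≤ walk g 0 ω ∧ ω ∈ negativeUpTo g 0} = 1 := by
      convert measure_univ (μ := iidLaw m)
      refine Set.eq_univ_of_forall fun ω => ⟨by simpa using hy, fun j h1 h2 => by omega⟩
    rw [h0, add_comm (1 : ℝ≥0∞), add_right_comm, ← ENNReal.tsum_add]
    congr 2
    funext n
    -- Split according to the sign of the walk at time `n + 1`; as `y ≥ 0`, the constraint `-y ≤
    -- walk` is automatic on `U n`.
    rw [← measure_union _ (hU n)]
    · congr 1
      ext ω
      simp only [Set.mem_union, Set.mem_ofPred_eq, U, negativeUpTo]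
      constructor
      · rintro ⟨h1, h2⟩
        rcases lt_or_ge (walk g (n + 1) ω) 0 with h | h
        · refine .inl ⟨h1, fun j h3 h4 => ?_⟩
          rcases h4.lt_or_eq with h5 | rfl
          · exact h2 j h3 (by omega)
          · exact h
        · exact .inr ⟨h, h2⟩
      · rintro (⟨h1, h2⟩ | ⟨h1, h2⟩)
        · exact ⟨h1, fun j h3 h4 => h2 j h3 (by omega)⟩
        · exact ⟨by linarith, h2⟩
    · exact Set.disjoint_left.2 fun ω h1 h2 =>
        (h1.2 (n + 1) (by omega) le_rfl).not_ge h2.1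

end Renewal

/-! ### Convexity of the primitive of a monotone harmonic function -/

section Convex

variable {r : ℝ → ℝ}

theorem mul_le_integral_of_monotone (hr : Monotone r) (a u : ℝ) :
    r a * u ≤ ∫ y in a..(a + u), r y := by
  rcases le_total 0 u with hu | hu
  · have := intervalIntegral.integral_mono_on (by linarith : a ≤ a + u)
      (intervalIntegrable_const (μ := volume) (c := r a)) hr.intervalIntegrable fun y hy => hr hy.1
    simp only [intervalIntegral.integral_const, smul_eq_mul] at this
    linarith
  · have := intervalIntegral.integral_mono_on (by linarith : a + u ≤ a)
      hr.intervalIntegrable (intervalIntegrable_const (μ := volume) (c := r a)) fun y hy => hr hy.2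
    simp only [intervalIntegral.integral_const, smul_eq_mul] at this
    rw [intervalIntegral.integral_symm]
    linarith

theorem integral_le_mul_of_monotone (hr : Monotone r) (a u : ℝ) :
    ∫ y in a..(a + u), r y ≤ r (a + u) * u := by
  have := mul_le_integral_of_monotone hr (a + u) (-u)
  rw [intervalIntegral.integral_symm] at this
  simp only [add_neg_cancel_right] at this
  linarith

variable {E : Type*} [MeasurableSpace E] {m : Measure E} [IsProbabilityMeasure m] {g : E → ℝ}

/-- Integrating the equation `E[r (y + X)] = r y - p` over `[0, t]`. -/
theorem integral_primitive_of_harmonic (hr : Monotone r) {K : ℝ} (hrK : ∀ y, |r y| ≤ K * (2 + |y|))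
    (hg : Measurable g) (hgi : Integrable g m) {p : ℝ}
    (hp : ∀ y, 0 ≤ y → ∫ e, r (y + g e) ∂m = r y - p) {t : ℝ} (ht : 0 ≤ t) :
    Integrable (fun e => (∫ y in (0 : ℝ)..(t + g e), r y) - ∫ y in (0 : ℝ)..g e, r y) m ∧
    ∫ e, ((∫ y in (0 : ℝ)..(t + g e), r y) - ∫ y in (0 : ℝ)..g e, r y) ∂m =
      (∫ y in (0 : ℝ)..t, r y) - p * t := by
  have hshift : ∀ e, (∫ y in (0 : ℝ)..(t + g e), r y) - ∫ y in (0 : ℝ)..g e, r y =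
      ∫ y in Set.Ioc 0 t, r (y + g e) := by
    intro e
    rw [intervalIntegral.integral_interval_sub_left hr.intervalIntegrable hr.intervalIntegrable,
      ← intervalIntegral.integral_of_le ht, intervalIntegral.integral_comp_add_right, zero_add]
  have hint : Integrable (Function.uncurry fun (e : E) (y : ℝ) => r (y + g e))
      (m.prod (volume.restrict (Set.Ioc 0 t))) := by
    have hb : Integrable (fun e => |K| * (2 + t + |g e|)) m :=
      ((integrable_const _).add hgi.abs).const_mul _
    refine (hb.comp_fst (volume.restrict (Set.Ioc 0 t))).mono' ?_ ?_
    · have hz : Measurable fun z : E × ℝ => z.2 + g z.1 := by fun_prop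
      exact (hr.measurable.comp hz).aestronglyMeasurable
    · have h2 : ∀ᵐ z ∂(m.prod (volume.restrict (Set.Ioc 0 t))), z.2 ∈ Set.Ioc 0 t :=
        Measure.quasiMeasurePreserving_snd.ae (ae_restrict_mem measurableSet_Ioc)
      filter_upwards [h2] with z hz
      refine (hrK _).trans ((mul_le_mul_of_nonneg_right (le_abs_self K) (by positivity)).trans ?_)
      refine mul_le_mul_of_nonneg_left ?_ (abs_nonneg K)
      have := abs_add_le z.2 (g z.1)
      rw [abs_of_pos hz.1] at this
      linarith [hz.2]
  simp only [hshift]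
  refine ⟨hint.integral_prod_left, ?_⟩
  rw [integral_integral_swap hint, setIntegral_congr_fun measurableSet_Ioc fun y hy => hp y hy.1.le,
    ← intervalIntegral.integral_of_le ht, intervalIntegral.integral_sub hr.intervalIntegrable
      intervalIntegrable_const]
  simp [mul_comm]

/-- Let `I` be the primitive of `r`, which is convex. Then `E[I(t+X)] ≥ I(t)` because `X` is
centered, while `E[I(X)] ≤ B < ∞` by the second moment. The integrated equation leaves `p t ≤ B` for
all integers `t ≥ 0`, so `p ≤ 0`. -/
theorem nonpos_of_harmonic_defect (hr : Monotone r) {K : ℝ} (hrK : ∀ y, |r y| ≤ K * (2 + |y|))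
    (hg : Measurable g) (hgi : Integrable g m) (hg2 : Integrable (fun e => g e ^ 2) m)
    (hg0 : ∫ e, g e ∂m = 0) {p : ℝ}
    (hp : ∀ y, 0 ≤ y → ∫ e, r (y + g e) ∂m = r y - p) : p ≤ 0 := by
  set B := ∫ e, K * (2 * |g e| + g e ^ 2) ∂m
  have hBi : Integrable (fun e => K * (2 * |g e| + g e ^ 2)) m :=
    ((hgi.abs.const_mul 2).add hg2).const_mul K
  have key : ∀ N : ℕ, p * N ≤ B := by
    intro N
    obtain ⟨h1, h2⟩ := integral_primitive_of_harmonic hr hrK hg hgi hp (Nat.cast_nonneg N)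
    set I := ∫ y in (0 : ℝ)..N, r y
    have h3 : Integrable (fun e => I + r N * g e) m := (integrable_const I).add (hgi.const_mul _)
    have h4 : ∫ e, (I + r N * g e - K * (2 * |g e| + g e ^ 2)) ∂m ≤ I - p * N := by
      rw [← h2]
      refine integral_mono (h3.sub hBi) h1 fun e => ?_
      have h5 := mul_le_integral_of_monotone hr (N : ℝ) (g e)
      have h6 := integral_le_mul_of_monotone hr 0 (g e)
      have h7 : r (g e) * g e ≤ K * (2 * |g e| + g e ^ 2) := by
        calc r (g e) * g e ≤ |r (g e)| * |g e| := by rw [← abs_mul]; exact le_abs_self _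
          _ ≤ K * (2 + |g e|) * |g e| := by gcongr; exact hrK _
          _ = K * (2 * |g e| + g e ^ 2) := by rw [← sq_abs (g e)]; ring
      have h8 : (∫ y in (0 : ℝ)..(N + g e), r y) = I + ∫ y in (N : ℝ)..(N + g e), r y :=
        (intervalIntegral.integral_add_adjacent_intervals hr.intervalIntegrable
          hr.intervalIntegrable).symm
      simp only [zero_add] at h6
      linarith
    rw [integral_sub h3 hBi, integral_add (integrable_const I) (hgi.const_mul _),
      integral_const_mul, hg0] at h4
    simp only [integral_const, probReal_univ, one_smul, mul_zero, add_zero] at h4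
    linarith
  by_contra! hpos
  obtain ⟨N, hN⟩ := exists_nat_gt (B / p)
  rw [div_lt_iff₀ hpos] at hN
  linarith [key N]

/-- With `I` the primitive of `r`, the integrated equation gives `E[I(X)] = E[I(N+X) - I(N)]`. If
`r` were bounded it would converge, and the right side, corrected by its mean-zero linear part `r(N)
X`, would be at most `E[D N] → 0`. But `I(X) ≥ X⁺`, so `X⁺ = 0` a.s., which is excluded. -/
theorem not_bounded_of_harmonic (hr : Monotone r) (hneg : ∀ y < 0, r y = 0)
    (hone : ∀ y, 0 ≤ y → 1 ≤ r y)
    (hg : Measurable g) (hgi : Integrable g m)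
    (hg0 : ∫ e, g e ∂m = 0) (hpos : 0 < m {e | 0 < g e})
    (hp : ∀ y, 0 ≤ y → ∫ e, r (y + g e) ∂m = r y) : ¬ BddAbove (Set.range r) := by
  intro hbdd
  obtain ⟨L, hL⟩ := hbdd
  have hrL : ∀ y, r y ≤ L := fun y => hL ⟨y, rfl⟩
  have hr0 : ∀ y, 0 ≤ r y := fun y => by
    rcases lt_or_ge y 0 with h | h
    · exact (hneg y h).ge
    · linarith [hone y h]
  have hrK : ∀ y, |r y| ≤ L * (2 + |y|) := fun y => by
    rw [abs_of_nonneg (hr0 y)]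
    have := (hr0 y).trans (hrL y)
    nlinarith [hrL y, abs_nonneg y, mul_nonneg this (abs_nonneg y)]
  set D : ℕ → E → ℝ := fun N e => |g e| * (r (N + |g e|) - r (N - |g e|))
  have hDm : ∀ N, Measurable (D N) := fun N => by
    have h1 : Measurable fun e => r (N + |g e|) := hr.measurable.comp (by fun_prop)
    have h2 : Measurable fun e => r (N - |g e|) := hr.measurable.comp (by fun_prop)
    exact (measurable_abs.comp hg).mul (h1.sub h2)
  have hDb : ∀ N e, ‖D N e‖ ≤ |g e| * L := fun N e => by
    have h1 : r (N - |g e|) ≤ r (N + |g e|) := hr (by linarith [abs_nonneg (g e)])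
    rw [Real.norm_of_nonneg (mul_nonneg (abs_nonneg _) (sub_nonneg.2 h1))]
    exact mul_le_mul_of_nonneg_left (by linarith [hrL (N + |g e|), hr0 (N - |g e|)]) (abs_nonneg _)
  have hDi : ∀ N, Integrable (D N) m := fun N =>
    (hgi.abs.mul_const L).mono' (hDm N).aestronglyMeasurable (.of_forall (hDb N))
  have hlim : Tendsto (fun N => ∫ e, D N e ∂m) atTop (𝓝 0) := by
    have := tendsto_integral_of_dominated_convergence (μ := m) (F := D) (f := fun _ => (0 : ℝ))
      (fun e => |g e| * L) (fun N => (hDm N).aestronglyMeasurable) (hgi.abs.mul_const L)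
      (fun N => .of_forall (hDb N)) (.of_forall fun e => ?_)
    · simpa using this
    · have hlimr := tendsto_atTop_ciSup hr ⟨L, hL⟩
      have h1 : Tendsto (fun N : ℕ => (N : ℝ) + |g e|) atTop atTop :=
        tendsto_atTop_add_const_right _ _ tendsto_natCast_atTop_atTop
      have h2 : Tendsto (fun N : ℕ => (N : ℝ) - |g e|) atTop atTop :=
        tendsto_atTop_add_const_right _ _ tendsto_natCast_atTop_atTop
      simpa using ((hlimr.comp h1).sub (hlimr.comp h2)).const_mul |g e|
  have hposi : Integrable (fun e => max (g e) 0) m := hgi.pos_part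
  have key : ∀ N : ℕ, ∫ e, max (g e) 0 ∂m ≤ ∫ e, D N e ∂m := by
    intro N
    obtain ⟨h1, h2⟩ := integral_primitive_of_harmonic hr hrK hg hgi (p := 0) (by simpa using hp)
      (Nat.cast_nonneg N)
    set I := ∫ y in (0 : ℝ)..N, r y
    have h3 : Integrable (fun e => I + r N * g e) m := (integrable_const I).add (hgi.const_mul _)
    have h4 : I - 0 * N ≤ ∫ e, (I + r N * g e + (D N e - max (g e) 0)) ∂m := by
      rw [← h2]
      refine integral_mono h1 (h3.add ((hDi N).sub hposi)) fun e => ?_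
      have h5 := integral_le_mul_of_monotone hr (N : ℝ) (g e)
      have h6 : max (g e) 0 ≤ ∫ y in (0 : ℝ)..g e, r y := by
        rcases le_or_gt 0 (g e) with h | h
        · have := mul_le_integral_of_monotone hr 0 (g e)
          rw [zero_add] at this
          rw [max_eq_left h]
          nlinarith [hone 0 le_rfl]
        · rw [max_eq_right h.le]
          rw [intervalIntegral.integral_symm, intervalIntegral.integral_of_le h.le,
            integral_Ioc_eq_integral_Ioo, setIntegral_congr_fun (g := fun _ => (0 : ℝ))
              measurableSet_Ioo fun y hy => hneg y hy.2]
          simp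
      have h7 : r (N + g e) * g e ≤ r N * g e + D N e := by
        rcases le_total 0 (g e) with h | h
        · simp only [D, abs_of_nonneg h]
          nlinarith [hr (show (N : ℝ) - g e ≤ N by linarith)]
        · simp only [D, abs_of_nonpos h, sub_neg_eq_add]
          nlinarith [hr (show (N : ℝ) ≤ N + -g e by linarith)]
      have h8 : (∫ y in (0 : ℝ)..(N + g e), r y) = I + ∫ y in (N : ℝ)..(N + g e), r y :=
        (intervalIntegral.integral_add_adjacent_intervals hr.intervalIntegrable
          hr.intervalIntegrable).symm
      linarith
    have h9 : Integrable (fun e => D N e - max (g e) 0) m := (hDi N).sub hposi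
    rw [integral_add h3 h9, integral_sub (hDi N) hposi,
      integral_add (integrable_const I) (hgi.const_mul _), integral_const_mul, hg0] at h4
    simp only [integral_const, probReal_univ, one_smul, mul_zero, add_zero, zero_mul, sub_zero] at h4
    linarith
  have hzero : ∫ e, max (g e) 0 ∂m = 0 :=
    le_antisymm (ge_of_tendsto' hlim key) (integral_nonneg fun e => le_max_right _ _)
  have hae : (fun e => max (g e) 0) =ᵐ[m] 0 :=
    (integral_eq_zero_iff_of_nonneg (fun e => le_max_right (g e) 0) hposi).1 hzero
  refine hpos.ne' (measure_mono_null (fun e he => ?_) hae)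
  simp only [Set.mem_ofPred_eq] at he
  simp [he]

end Convex

/-! ### Centered walks: exact harmonicity and divergence of the renewal function -/

section Centered

variable {E : Type*} [MeasurableSpace E] {m : Measure E} {g : E → ℝ}

/-- The step distribution of a non-degenerate centered random walk with finite variance. -/
structure IsCenteredStep (m : Measure E) (g : E → ℝ) : Prop where
  measurable : Measurable g
  integrable : Integrable g m
  integrable_sq : Integrable (fun e => g e ^ 2) m
  integral_eq_zero : ∫ e, g e ∂m = 0
  pos : 0 < m {e | 0 < g e}
  neg : 0 < m {e | g e < 0}

theorem measurable_descRenewal : Measurable (descRenewal m g) := (descRenewal_mono m).measurable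

theorem measurable_descRenewal_add (hg : Measurable g) (y : ℝ) :
    Measurable fun e => descRenewal m g (y + g e) :=
  measurable_descRenewal.comp (hg.const_add y)

variable [IsProbabilityMeasure m]

theorem exists_toReal_descRenewal_bound (h : IsCenteredStep m g) :
    ∃ K : ℝ, ∀ y, |(descRenewal m g y).toReal| ≤ K * (2 + |y|) := by
  obtain ⟨C, hC, hb⟩ := exists_descRenewal_bound m h.measurable h.neg
  refine ⟨C.toReal, fun y => ?_⟩
  have h1 : descRenewal m g y ≤ C * (⌈|y|⌉₊ + 1) :=
    (descRenewal_mono m ((le_abs_self y).trans (Nat.le_ceil _))).trans (hb _)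
  have h2 := ENNReal.toReal_mono (ENNReal.mul_ne_top hC (by simp)) h1
  rw [abs_of_nonneg ENNReal.toReal_nonneg]
  refine h2.trans ?_
  rw [ENNReal.toReal_mul, ENNReal.toReal_add (by simp) (by simp)]
  simp only [ENNReal.toReal_natCast, ENNReal.toReal_one]
  refine mul_le_mul_of_nonneg_left ?_ ENNReal.toReal_nonneg
  linarith [Nat.ceil_lt_add_one (abs_nonneg y)]

theorem toReal_descRenewal_mono (h : IsCenteredStep m g) :
    Monotone fun y => (descRenewal m g y).toReal := fun _ y hxy =>
  ENNReal.toReal_mono (descRenewal_ne_top m h.measurable h.neg y) (descRenewal_mono m hxy)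

/-- The renewal function is harmonic for the walk killed when it becomes negative. -/
theorem lintegral_descRenewal (h : IsCenteredStep m g) {y : ℝ} (hy : 0 ≤ y) :
    ∫⁻ e, descRenewal m g (y + g e) ∂m = descRenewal m g y := by
  obtain ⟨q, hq1, hq⟩ := exists_lintegral_descRenewal m h.measurable
  have hqt : q ≠ ∞ := ne_top_of_le_ne_top ENNReal.one_ne_top hq1
  have hfin := descRenewal_ne_top m h.measurable h.neg
  have hI : ∀ y, 0 ≤ y → ∫⁻ e, descRenewal m g (y + g e) ∂m ≠ ∞ := fun y hy =>
    ne_top_of_le_ne_top (ENNReal.add_ne_top.2 ⟨hfin y, hqt⟩) (le_self_add.trans (hq y hy).le)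
  have hint : ∀ y, 0 ≤ y → ∫ e, (descRenewal m g (y + g e)).toReal ∂m =
      (descRenewal m g y).toReal - (1 - q.toReal) := by
    intro y hy
    rw [integral_toReal (measurable_descRenewal_add h.measurable y).aemeasurable
      (.of_forall fun e => (hfin _).lt_top)]
    have := congrArg ENNReal.toReal (hq y hy)
    rw [ENNReal.toReal_add (hI y hy) ENNReal.one_ne_top, ENNReal.toReal_add (hfin y) hqt,
      ENNReal.toReal_one] at this
    linarith
  obtain ⟨K, hK⟩ := exists_toReal_descRenewal_bound h
  have hp := nonpos_of_harmonic_defect (toReal_descRenewal_mono h) hK h.measurable h.integrable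
    h.integrable_sq h.integral_eq_zero hint
  -- The defect is `p = 1 - q`, so `p ≤ 0` forces `q = 1`.
  have hq' : q = 1 := by
    refine le_antisymm hq1 ?_
    rw [← ENNReal.toReal_le_toReal ENNReal.one_ne_top hqt, ENNReal.toReal_one]
    linarith
  have := hq y hy
  rw [hq'] at this
  exact (ENNReal.add_left_inj ENNReal.one_ne_top).1 this

theorem tendsto_descRenewal (h : IsCenteredStep m g) :
    Tendsto (descRenewal m g) atTop (𝓝 ∞) := by
  have hfin := descRenewal_ne_top m h.measurable h.neg
  have hub := not_bounded_of_harmonic (toReal_descRenewal_mono h)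
    (fun y hy => by simp [descRenewal_of_neg m hy])
    (fun y hy => by
      rw [← ENNReal.toReal_one]
      exact ENNReal.toReal_mono (hfin y) (one_le_descRenewal m hy))
    h.measurable h.integrable h.integral_eq_zero h.pos (fun y hy => by
      rw [integral_toReal (measurable_descRenewal_add h.measurable y).aemeasurable
        (.of_forall fun e => (hfin _).lt_top), lintegral_descRenewal h hy])
  rw [ENNReal.tendsto_nhds_top_iff_nat]
  intro N
  obtain ⟨_, ⟨x, rfl⟩, hx⟩ := not_bddAbove_iff.1 hub N
  filter_upwards [eventually_ge_atTop x] with y hy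
  refine lt_of_lt_of_le ?_ (descRenewal_mono m hy)
  rw [← ENNReal.toReal_lt_toReal (by simp) (hfin x)]
  simpa using hx

end Centered

/-! ### The spine step is centered with finite variance -/

section SpineStep

/-- The displacement of the child that continues the spine. -/
def displacement (e : Offspring × ℕ) : ℝ := (e.1 e.2).untopD 0

theorem measurable_offspring_apply : Measurable fun e : Offspring × ℕ => e.1 e.2 :=
  measurable_from_prod_countable_left fun i => measurable_pi_apply i

theorem measurable_displacement : Measurable displacement :=
  (by fun_prop : Measurable fun a : WithTop ℝ => a.untopD 0).comp measurable_offspring_apply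

variable {Θ : Measure Offspring}

/-- One-step many-to-one formula: the size-biasing factor cancels the normalization in the choice of
the child. -/
theorem lintegral_spineStep (hΘ : IsBoundaryCase Θ) {H : Offspring × ℕ → ℝ≥0∞}
    (hH : Measurable H) :
    ∫⁻ e, H e ∂spineStep Θ = ∫⁻ θ, ∑' i, weight (θ i) * H (θ, i) ∂Θ := by
  have hw : ∀ i : ℕ, Measurable fun θ : Offspring => weight (θ i) :=
    fun i => measurable_weight.comp (measurable_pi_apply i)
  have hm : ∀ i : ℕ, Measurable fun θ : Offspring => weight (θ i) / ∑' j, weight (θ j) :=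
    fun i => (hw i).div measurable_weight_sum
  have hpair : ∀ i : ℕ, Measurable fun θ : Offspring => (θ, i) := fun i => by fun_prop
  have hHi : ∀ i : ℕ, Measurable fun θ : Offspring => H (θ, i) := fun i => hH.comp (hpair i)
  have hfin : ∀ᵐ θ ∂Θ, ∑' i, weight (θ i) < ∞ :=
    ae_lt_top measurable_weight_sum (by rw [hΘ.total_weight]; exact ENNReal.one_ne_top)
  rw [spineStep, lintegral_sum_measure, lintegral_tsum (f := fun i θ => weight (θ i) * H (θ, i))
    fun i => ((hw i).mul (hHi i)).aemeasurable]
  refine tsum_congr fun i => ?_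
  rw [lintegral_map hH (hpair i), lintegral_withDensity_eq_lintegral_mul _ (hm i) (hHi i),
    sizeBiased, lintegral_withDensity_eq_lintegral_mul _ measurable_weight_sum
      ((hm i).mul (hHi i))]
  refine lintegral_congr_ae ?_
  filter_upwards [hfin] with θ hθ
  simp only [Pi.mul_apply, ← mul_assoc]
  congr 1
  -- Where the total weight is zero the quotient does not cancel, but then every single weight
  -- vanishes too.
  by_cases h0 : ∑' j, weight (θ j) = 0
  · simp [h0, ENNReal.tsum_eq_zero.1 h0 i]
  · exact ENNReal.mul_div_cancel h0 hθ.ne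

theorem ae_spineStep_ne_top (hΘ : IsBoundaryCase Θ) : ∀ᵐ e ∂spineStep Θ, e.1 e.2 ≠ ⊤ := by
  have hs : MeasurableSet {e : Offspring × ℕ | e.1 e.2 = ⊤} :=
    measurable_offspring_apply (measurableSet_singleton _)
  rw [ae_iff]
  simp only [ne_eq, not_not]
  rw [← lintegral_indicator_one hs, lintegral_spineStep hΘ (measurable_one.indicator hs)]
  have : ∀ (θ : Offspring) (i : ℕ),
      weight (θ i) * Set.indicator {e : Offspring × ℕ | e.1 e.2 = ⊤} 1 (θ, i) = 0 := by
    intro θ i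
    by_cases h : θ i = ⊤
    · simp [h, weight]
    · simp [h]
  simp [this]

theorem weight_mul_sq (a : WithTop ℝ) :
    weight a * ENNReal.ofReal (a.untopD 0 ^ 2) = sqWeight a := by
  induction a using WithTop.recTopCoe with
  | top => simp [weight, sqWeight]
  | coe r =>
    simp only [weight, sqWeight, WithTop.recTopCoe_coe, WithTop.untopD_coe]
    rw [← ENNReal.ofReal_mul (Real.exp_nonneg _), mul_comm]

theorem weight_mul_pos (a : WithTop ℝ) :
    weight a * ENNReal.ofReal (a.untopD 0) = ENNReal.ofReal (linWeight a) := by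
  induction a using WithTop.recTopCoe with
  | top => simp [weight, linWeight]
  | coe r =>
    simp only [weight, linWeight, WithTop.recTopCoe_coe, WithTop.untopD_coe]
    rw [← ENNReal.ofReal_mul (Real.exp_nonneg _), mul_comm]

theorem weight_mul_neg (a : WithTop ℝ) :
    weight a * ENNReal.ofReal (-a.untopD 0) = ENNReal.ofReal (-linWeight a) := by
  induction a using WithTop.recTopCoe with
  | top => simp [weight, linWeight]
  | coe r =>
    simp only [weight, linWeight, WithTop.recTopCoe_coe, WithTop.untopD_coe]
    rw [← ENNReal.ofReal_mul (Real.exp_nonneg _), mul_comm, neg_mul]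

theorem measurable_linWeight : Measurable linWeight :=
  WithTop.measurable_of_measurable_comp_coe (by
    simp only [linWeight, WithTop.recTopCoe_coe]; fun_prop)

theorem tsum_eq_toReal_sub_toReal {a : ℕ → ℝ} (h1 : ∑' i, ENNReal.ofReal (a i) ≠ ∞)
    (h2 : ∑' i, ENNReal.ofReal (-a i) ≠ ∞) :
    ∑' i, a i = (∑' i, ENNReal.ofReal (a i)).toReal - (∑' i, ENNReal.ofReal (-a i)).toReal := by
  rw [ENNReal.tsum_toReal_eq fun i => ENNReal.ofReal_ne_top,
    ENNReal.tsum_toReal_eq fun i => ENNReal.ofReal_ne_top,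
    ← (ENNReal.summable_toReal h1).tsum_sub (ENNReal.summable_toReal h2)]
  refine tsum_congr fun i => ?_
  rw [ENNReal.toReal_ofReal', ENNReal.toReal_ofReal', max_comm, max_comm (-a i)]
  exact (max_zero_sub_max_neg_zero_eq_self (a i)).symm.trans (by rw [max_comm, max_comm (-a i)])

theorem lintegral_displacement_sq (hΘ : IsBoundaryCase Θ) :
    ∫⁻ e, ENNReal.ofReal (displacement e ^ 2) ∂spineStep Θ =
      ∫⁻ θ, ∑' i, sqWeight (θ i) ∂Θ := by
  rw [lintegral_spineStep hΘ (measurable_displacement.pow_const 2).ennreal_ofReal]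
  simp only [displacement, weight_mul_sq]

/-- Under the standing assumptions the spine performs a centered random walk. -/
theorem isCenteredStep_spineStep (hΘ : IsBoundaryCase Θ) :
    IsCenteredStep (spineStep Θ) displacement := by
  have := isProbabilityMeasure_spineStep hΘ
  have hm := measurable_displacement
  have hsq : Integrable (fun e => displacement e ^ 2) (spineStep Θ) := by
    refine ⟨(hm.pow_const 2).aestronglyMeasurable, ?_⟩
    rw [hasFiniteIntegral_iff_ofReal (.of_forall fun e => sq_nonneg _),
      lintegral_displacement_sq hΘ]
    exact hΘ.variance_lt_top
  have hint : Integrable displacement (spineStep Θ) := by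
    refine ((integrable_const (1 : ℝ)).add hsq).mono' hm.aestronglyMeasurable
      (.of_forall fun e => ?_)
    simp only [Pi.add_apply, Real.norm_eq_abs]
    nlinarith [sq_abs (displacement e), sq_nonneg (|displacement e| - 1)]
  have hzero : ∫ e, displacement e ∂spineStep Θ = 0 := by
    have hP := lintegral_spineStep hΘ hm.ennreal_ofReal
    have hN := lintegral_spineStep hΘ hm.neg.ennreal_ofReal
    simp only [displacement, Pi.neg_apply, weight_mul_pos, weight_mul_neg] at hP hN
    have hPt : ∫⁻ θ, ∑' i, ENNReal.ofReal (linWeight (θ i)) ∂Θ ≠ ∞ := by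
      rw [← hP]; exact hint.lintegral_lt_top.ne
    have hNt : ∫⁻ θ, ∑' i, ENNReal.ofReal (-linWeight (θ i)) ∂Θ ≠ ∞ := by
      rw [← hN]; exact hint.neg.lintegral_lt_top.ne
    have hl : ∀ i : ℕ, Measurable fun θ : Offspring => linWeight (θ i) :=
      fun i => measurable_linWeight.comp (measurable_pi_apply i)
    have hPm : Measurable fun θ : Offspring => ∑' i, ENNReal.ofReal (linWeight (θ i)) :=
      Measurable.tsum fun i => (hl i).ennreal_ofReal
    have hNm : Measurable fun θ : Offspring => ∑' i, ENNReal.ofReal (-linWeight (θ i)) :=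
      Measurable.tsum fun i => (hl i).neg.ennreal_ofReal
    have hPa := ae_lt_top hPm hPt
    have hNa := ae_lt_top hNm hNt
    rw [integral_eq_lintegral_pos_part_sub_lintegral_neg_part hint]
    simp only [displacement]
    rw [hP, hN, ← integral_toReal hPm.aemeasurable hPa, ← integral_toReal hNm.aemeasurable hNa,
      ← integral_sub (integrable_toReal_of_lintegral_ne_top hPm.aemeasurable hPt)
        (integrable_toReal_of_lintegral_ne_top hNm.aemeasurable hNt), ← hΘ.mean]
    refine integral_congr_ae ?_
    filter_upwards [hPa, hNa] with θ h1 h2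
    exact (tsum_eq_toReal_sub_toReal h1.ne h2.ne).symm
  have hne : ¬ displacement =ᵐ[spineStep Θ] 0 := by
    intro h0
    have h1 := hΘ.variance_pos
    rw [← lintegral_displacement_sq hΘ] at h1
    refine h1.ne' ?_
    rw [lintegral_congr_ae (g := 0) (by filter_upwards [h0] with e he; simp [he])]
    simp
  -- A centered variable of constant sign is a.s. zero, against the positive variance.
  refine ⟨hm, hint, hsq, hzero, pos_iff_ne_zero.2 fun h => hne ?_,
    pos_iff_ne_zero.2 fun h => hne ?_⟩
  · have h1 : ∀ᵐ e ∂spineStep Θ, displacement e ≤ 0 := by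
      rw [ae_iff]; simpa using h
    have h2 := (integral_eq_zero_iff_of_nonneg_ae (f := fun e => -displacement e)
      (by filter_upwards [h1] with e he; simpa using he) hint.neg).1
      (by rw [integral_neg, hzero, neg_zero])
    filter_upwards [h2] with e he
    simpa using he
  · have h1 : ∀ᵐ e ∂spineStep Θ, 0 ≤ displacement e := by
      rw [ae_iff]; simpa using h
    exact (integral_eq_zero_iff_of_nonneg_ae h1 hint).1 hzero

end SpineStep

/-! ### Spine positions as a random walk -/

section SpinePosition

variable {Θ : Measure Offspring}

@[simp] theorem length_rayVertex (r : ℕ → ℕ) (n : ℕ) : (rayVertex r n).length = n := by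
  induction n with
  | zero => rfl
  | succ n ih => simp [rayVertex, ih]

/-- The positions and the ray that a realization of the noise produces. -/
def noisePath (x : ℝ) (ν : Noise) : Path := (noisePosition x ν, noiseRay ν)

theorem measurable_noisePath (x : ℝ) : Measurable (noisePath x) :=
  (measurable_noisePosition x).prodMk measurable_noiseRay

theorem spinalLaw_eq_map (x : ℝ) : spinalLaw Θ x = (noiseLaw Θ).map (noisePath x) := rfl

theorem noisePosition_rayVertex (x : ℝ) {ν : Noise} (hν : ∀ i, (ν.2 i).1 (ν.2 i).2 ≠ ⊤) (n : ℕ) :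
    noisePosition x ν (rayVertex (noiseRay ν) n) =
      ((x + walk displacement n ν.2 : ℝ) : WithTop ℝ) := by
  induction n with
  | zero => simp [rayVertex, noisePosition]
  | succ n ih =>
    obtain ⟨d, hd⟩ := WithTop.ne_top_iff_exists.1 (hν n)
    have h1 : noiseOffspring ν (rayVertex (noiseRay ν) n) (noiseRay ν n) = (d : WithTop ℝ) := by
      simp only [noiseOffspring, length_rayVertex, if_true, noiseRay, hd]
    have h2 : displacement (ν.2 n) = d := by rw [displacement, ← hd, WithTop.untopD_coe]
    rw [rayVertex, noisePosition, ih, h1, walk_succ, h2, ← WithTop.coe_add, add_assoc]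

theorem spinePos_noisePath (x : ℝ) {ν : Noise} (hν : ∀ i, (ν.2 i).1 (ν.2 i).2 ≠ ⊤) (n : ℕ) :
    spinePos n (noisePath x ν) = x + walk displacement n ν.2 := by
  have := noisePosition_rayVertex x hν n
  simp only [spinePos, spine, noisePath, this, WithTop.untopD_coe]

theorem ae_iidLaw_ne_top (hΘ : IsBoundaryCase Θ) :
    ∀ᵐ ω ∂iidLaw (spineStep Θ), ∀ i, (ω i).1 (ω i).2 ≠ ⊤ := by
  have := isProbabilityMeasure_spineStep hΘ
  rw [ae_all_iff]
  intro i
  exact (measurePreserving_eval_infinitePi (fun _ : ℕ => spineStep Θ) i).quasiMeasurePreserving.ae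
    (ae_spineStep_ne_top hΘ)

theorem ae_noiseLaw_ne_top (hΘ : IsBoundaryCase Θ) :
    ∀ᵐ ν ∂noiseLaw Θ, ∀ i, (ν.2 i).1 (ν.2 i).2 ≠ ⊤ := by
  have := isProbabilityMeasure_spineStep hΘ
  exact Measure.quasiMeasurePreserving_snd.ae (ae_iidLaw_ne_top hΘ)

/-- The spine vertex takes countably many values, all of generation `k ≤ n`; on each of them the
position is that of a fixed vertex. -/
theorem measurable_sigmaUpTo_spinePos {k n : ℕ} (hk : k ≤ n) :
    Measurable[sigmaUpTo n] (spinePos k) := by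
  intro B hB
  have : spinePos k ⁻¹' B = ⋃ u : Vertex, ⋃ _ : u.length ≤ n,
      (spine k ⁻¹' {u}) ∩ ((fun ω : Path => ω.1 u) ⁻¹' ((fun a : WithTop ℝ => a.untopD 0) ⁻¹' B)) := by
    ext ω
    simp only [Set.mem_preimage, Set.mem_iUnion, Set.mem_inter_iff, Set.mem_singleton_iff,
      exists_prop, spinePos]
    constructor
    · exact fun h => ⟨spine k ω, by simpa [spine] using hk, rfl, h⟩
    · rintro ⟨u, -, rfl, h⟩
      exact h
  rw [this]
  refine MeasurableSet.iUnion fun u => MeasurableSet.iUnion fun hu => MeasurableSet.inter ?_ ?_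
  · refine (le_sup_of_le_right (le_iSup₂_of_le k hk le_rfl) :
      MeasurableSpace.comap (spine k) ⊤ ≤ sigmaUpTo n) _ ⟨{u}, trivial, rfl⟩
  · refine (le_sup_of_le_left (le_iSup₂_of_le u hu le_rfl) :
      MeasurableSpace.comap (fun ω : Path => ω.1 u) inferInstance ≤ sigmaUpTo n) _
        ⟨_, (by fun_prop : Measurable fun a : WithTop ℝ => a.untopD 0) hB, rfl⟩

theorem sigmaUpTo_le (n : ℕ) : sigmaUpTo n ≤ (inferInstance : MeasurableSpace Path) := by
  refine sup_le (iSup₂_le fun u _ => ?_) (iSup₂_le fun k _ => ?_)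
  · exact Measurable.comap_le (by fun_prop)
  · rintro _ ⟨B, -, rfl⟩
    have : spine k ⁻¹' B = ⋃ u ∈ B, {ω : Path | u = rayVertex ω.2 k} := by
      ext ω; simp [spine]
    rw [this]
    exact MeasurableSet.biUnion (Set.to_countable _) fun u _ =>
      measurable_snd (measurableSet_rayVertex_eq k u)

theorem measurable_spinePos (k : ℕ) : Measurable (spinePos k) :=
  (measurable_sigmaUpTo_spinePos le_rfl).mono (sigmaUpTo_le k) le_rfl

/-- The spine positions under `P*_x` form a random walk started at `x`. -/
theorem lintegral_spinalLaw (hΘ : IsBoundaryCase Θ) (x : ℝ) {F : (ℕ → ℝ) → ℝ≥0∞}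
    (hF : Measurable F) :
    ∫⁻ ω, F (fun k => spinePos k ω) ∂spinalLaw Θ x =
      ∫⁻ ω, F (fun k => x + walk displacement k ω) ∂iidLaw (spineStep Θ) := by
  have := isProbabilityMeasure_spineStep hΘ
  have := hΘ.prob
  have h1 : Measurable fun (ω : Path) (k : ℕ) => spinePos k ω :=
    measurable_pi_lambda _ measurable_spinePos
  have h2 : Measurable fun (ω : ℕ → Offspring × ℕ) (k : ℕ) => x + walk displacement k ω :=
    measurable_pi_lambda _ fun k => (measurable_walk measurable_displacement k).const_add x
  have hF1 : Measurable fun ω : Path => F fun k => spinePos k ω := hF.comp h1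
  have hF2 : Measurable fun ω : ℕ → Offspring × ℕ => F fun k => x + walk displacement k ω :=
    hF.comp h2
  rw [spinalLaw_eq_map, lintegral_map hF1 (measurable_noisePath x)]
  have h3 : (noiseLaw Θ).map Prod.snd = iidLaw (spineStep Θ) := by
    simp [noiseLaw, Measure.map_snd_prod]
  rw [← h3, lintegral_map hF2 measurable_snd]
  refine lintegral_congr_ae ?_
  filter_upwards [ae_noiseLaw_ne_top hΘ] with ν hν
  simp only [spinePos_noisePath x hν]

theorem spinalLaw_apply (hΘ : IsBoundaryCase Θ) (x : ℝ) {s : Set (ℕ → ℝ)}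
    (hs : MeasurableSet s) :
    spinalLaw Θ x {ω | (fun k => spinePos k ω) ∈ s} =
      iidLaw (spineStep Θ) {ω | (fun k => x + walk displacement k ω) ∈ s} := by
  have h := lintegral_spinalLaw hΘ x (measurable_one.indicator hs)
  have h1 : MeasurableSet {ω : Path | (fun k => spinePos k ω) ∈ s} :=
    (measurable_pi_lambda (fun (ω : Path) (k : ℕ) => spinePos k ω) measurable_spinePos) hs
  have h2 : MeasurableSet {ω : ℕ → Offspring × ℕ | (fun k => x + walk displacement k ω) ∈ s} :=
    (measurable_pi_lambda (fun (ω : ℕ → Offspring × ℕ) (k : ℕ) => x + walk displacement k ω)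
      fun k => (measurable_walk measurable_displacement k).const_add x) hs
  rw [← lintegral_indicator_one h1, ← lintegral_indicator_one h2]
  exact h

theorem renewal_eq_descRenewal (hΘ : IsBoundaryCase Θ) :
    renewal Θ = descRenewal (spineStep Θ) displacement := by
  funext x
  refine tsum_congr fun n => ?_
  have hs : MeasurableSet {s : ℕ → ℝ | -x ≤ s n ∧ ∀ k < n, s n < s k} := by
    simp only [measurableSet_setOfPred]; fun_prop
  have := spinalLaw_apply hΘ 0 hs
  simpa [strictDescent] using this

end SpinePosition

/-! ### The walk conditioned to stay nonnegative -/

section Existence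

open ProbabilityTheory Preorder

variable {E : Type*} [MeasurableSpace E] {m : Measure E} {g : E → ℝ}

open Classical in
/-- The density on the first `n` steps of the walk conditioned to stay nonnegative. -/
def walkDensity (m : Measure E) (g : E → ℝ) (x : ℝ) (n : ℕ) (ω : ℕ → E) : ℝ≥0∞ :=
  if ∀ k ≤ n, 0 ≤ x + walk g k ω then descRenewal m g (x + walk g n ω) / descRenewal m g x else 0

open Classical in
/-- The density of the step from `x + walk g n ω` of the walk conditioned to stay nonnegative. -/
def stepDensity (m : Measure E) (g : E → ℝ) (x : ℝ) (n : ℕ) (ω : ℕ → E) (e : E) : ℝ≥0∞ :=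
  if 0 ≤ x + walk g n ω then
    descRenewal m g (x + walk g n ω + g e) / descRenewal m g (x + walk g n ω) else 1

theorem measurable_walkDensity (hg : Measurable g) (x : ℝ) (n : ℕ) :
    Measurable (walkDensity m g x n) := by
  classical
  unfold walkDensity
  refine Measurable.ite ?_ ?_ measurable_const
  · simp only [measurableSet_setOfPred]; fun_prop
  · exact (measurable_descRenewal.comp ((measurable_walk hg n).const_add x)).div_const _

variable [IsProbabilityMeasure m]

/-- The Ionescu-Tulcea theorem for transition kernels with densities `d n` with respect to a fixed
probability measure. -/
theorem exists_measure_of_densities {d : ℕ → (ℕ → E) → E → ℝ≥0∞}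
    (hd : ∀ n, Measurable (Function.uncurry (d n)))
    (hdep : ∀ n ω ω' e, (∀ i < n, ω i = ω' i) → d n ω e = d n ω' e)
    (hone : ∀ n ω, ∫⁻ e, d n ω e ∂m = 1) :
    ∃ T : Measure (ℕ → E), IsProbabilityMeasure T ∧
      ∀ (n : ℕ) (G : (ℕ → E) → E → ℝ≥0∞), Measurable (Function.uncurry G) →
        (∀ ω ω' e, (∀ i < n, ω i = ω' i) → G ω e = G ω' e) →
        ∫⁻ ω, G ω (ω n) ∂T = ∫⁻ ω, ∫⁻ e, d n ω e * G ω e ∂m ∂T := by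
  obtain ⟨e₀⟩ : Nonempty E := nonempty_of_isProbabilityMeasure m
  -- Coordinate `0` of the trajectory is a dummy initial state of law `m`, so step `i` of the walk
  -- is coordinate `i + 1`. The unknown future is filled with `e₀`, which `hdep` makes irrelevant.
  let ext (n : ℕ) (h : Finset.Iic n → E) : ℕ → E := fun i =>
    if hi : i + 1 ≤ n then h ⟨i + 1, Finset.mem_Iic.2 hi⟩ else e₀
  have hext : ∀ n, Measurable (ext n) := fun n => by
    refine measurable_pi_lambda _ fun i => ?_
    by_cases hi : i + 1 ≤ n <;> simp only [ext, hi, dite_true, dite_false] <;> fun_prop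
  have hdm : ∀ n, Measurable (Function.uncurry fun (h : Finset.Iic n → E) e => d n (ext n h) e) :=
    fun n => (hd n).comp (((hext n).comp measurable_fst).prodMk measurable_snd)
  let κ (n : ℕ) : Kernel (Finset.Iic n → E) E :=
    Kernel.withDensity (Kernel.const _ m) fun h e => d n (ext n h) e
  have hκ : ∀ n, IsMarkovKernel (κ n) := fun n => ⟨fun h => ⟨by
    rw [Kernel.withDensity_apply' _ (hdm n), setLIntegral_univ]
    exact hone n _⟩⟩
  let T₀ : Measure (ℕ → E) := Kernel.trajMeasure (X := fun _ => E) m κ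
  let shift (ω : ℕ → E) : ℕ → E := fun i => ω (i + 1)
  have hshift : Measurable shift := by unfold shift; fun_prop
  have hagree : ∀ n ω, ∀ i < n, shift ω i = ext n (frestrictLe n ω) i := by
    intro n ω i hi
    simp only [shift, ext, dif_pos (Nat.succ_le_of_lt hi)]
    rfl
  refine ⟨T₀.map shift, Measure.isProbabilityMeasure_map hshift.aemeasurable, ?_⟩
  intro n G hG hGdep
  have hG1 : Measurable fun ω : ℕ → E => G ω (ω n) :=
    hG.comp (measurable_id.prodMk (measurable_pi_apply n))
  have hG2 : Measurable fun ω : ℕ → E => ∫⁻ e, d n ω e * G ω e ∂m :=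
    Measurable.lintegral_prod_right' (f := fun p : (ℕ → E) × E => d n p.1 p.2 * G p.1 p.2)
      ((hd n).mul hG)
  have hG3 : Measurable fun p : (Finset.Iic n → E) × E => G (ext n p.1) p.2 :=
    hG.comp (((hext n).comp measurable_fst).prodMk measurable_snd)
  rw [lintegral_map hG1 hshift, lintegral_map hG2 hshift]
  have hmeas : Measurable fun ω : ℕ → E => (frestrictLe (π := fun _ => E) n ω, ω (n + 1)) := by
    fun_prop
  calc ∫⁻ ω, G (shift ω) (shift ω n) ∂T₀
      = ∫⁻ ω, G (ext n (frestrictLe n ω)) (ω (n + 1)) ∂T₀ :=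
        lintegral_congr fun ω => hGdep _ _ _ (hagree n ω)
    _ = ∫⁻ p, G (ext n p.1) p.2 ∂T₀.map
          (fun ω : ℕ → E => (frestrictLe (π := fun _ => E) n ω, ω (n + 1))) :=
        (lintegral_map hG3 hmeas).symm
    _ = ∫⁻ p, G (ext n p.1) p.2 ∂((T₀.map (frestrictLe n)) ⊗ₘ κ n) := by
        rw [Kernel.map_frestrictLe_trajMeasure_compProd_eq_map_trajMeasure]
    _ = ∫⁻ h, ∫⁻ e, G (ext n h) e ∂κ n h ∂T₀.map (frestrictLe n) :=
        Measure.lintegral_compProd hG3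
    _ = ∫⁻ h, ∫⁻ e, d n (ext n h) e * G (ext n h) e ∂m ∂T₀.map (frestrictLe n) := by
        refine lintegral_congr fun h => ?_
        have hGh : Measurable (G (ext n h)) := hG3.comp measurable_prodMk_left
        rw [Kernel.lintegral_withDensity _ (hdm n) _ hGh]
        rfl
    _ = ∫⁻ ω, ∫⁻ e, d n (ext n (frestrictLe n ω)) e * G (ext n (frestrictLe n ω)) e ∂m ∂T₀ :=
        lintegral_map (hG2.comp (hext n)) (measurable_frestrictLe n)
    _ = ∫⁻ ω, ∫⁻ e, d n (shift ω) e * G (shift ω) e ∂m ∂T₀ := by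
        refine lintegral_congr fun ω => lintegral_congr fun e => ?_
        rw [hdep n _ _ e (hagree n ω), hGdep _ _ e (hagree n ω)]

/-- A consistent sequence of densities with respect to an i.i.d. law comes from a probability
measure on the space of sequences. -/
theorem exists_measure_of_density_process {d : ℕ → (ℕ → E) → E → ℝ≥0∞}
    (hd : ∀ n, Measurable (Function.uncurry (d n)))
    (hdep : ∀ n ω ω' e, (∀ i < n, ω i = ω' i) → d n ω e = d n ω' e)
    (hone : ∀ n ω, ∫⁻ e, d n ω e ∂m = 1)
    {D : ℕ → (ℕ → E) → ℝ≥0∞} (hD : ∀ n, Measurable (D n))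
    (hDdep : ∀ n ω ω', (∀ i < n, ω i = ω' i) → D n ω = D n ω')
    (hD0 : ∀ ω, D 0 ω = 1) (hDsucc : ∀ n ω, D (n + 1) ω = D n ω * d n ω (ω n)) :
    ∃ T : Measure (ℕ → E), IsProbabilityMeasure T ∧
      ∀ (n : ℕ) (F : (ℕ → E) → ℝ≥0∞), Measurable F →
        (∀ ω ω', (∀ i < n, ω i = ω' i) → F ω = F ω') →
        ∫⁻ ω, F ω ∂T = ∫⁻ ω, F ω * D n ω ∂iidLaw m := by
  obtain ⟨T, hT, h⟩ := exists_measure_of_densities hd hdep hone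
  refine ⟨T, hT, fun n => ?_⟩
  induction n with
  | zero =>
    intro F hF hFdep
    obtain ⟨ω₀⟩ : Nonempty (ℕ → E) := nonempty_of_isProbabilityMeasure T
    have : ∀ ω, F ω = F ω₀ := fun ω => hFdep _ _ (by simp)
    simp [this, hD0]
  | succ n ih =>
    intro F hF hFdep
    let snoc (ω : ℕ → E) (e : E) : ℕ → E := fun i => if i < n then ω i else e
    have hsnoc : Measurable fun p : (ℕ → E) × E => snoc p.1 p.2 := by
      refine measurable_pi_lambda _ fun i => ?_
      by_cases hi : i < n <;> simp only [snoc, hi, if_true, if_false] <;> fun_prop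
    have hFsnoc : ∀ ω, F ω = F (snoc ω (ω n)) := fun ω => hFdep _ _ fun i hi => by
      by_cases hin : i < n
      · simp [snoc, hin]
      · obtain rfl : i = n := by omega
        simp [snoc]
    have hG : Measurable (Function.uncurry fun ω e => F (snoc ω e)) := hF.comp hsnoc
    have hGdep : ∀ ω ω' e, (∀ i < n, ω i = ω' i) → F (snoc ω e) = F (snoc ω' e) := by
      intro ω ω' e hag
      congr 1
      funext i
      by_cases hin : i < n <;> simp [snoc, hin, hag]
    have hdG : Measurable fun p : (ℕ → E) × E => d n p.1 p.2 * F (snoc p.1 p.2) := (hd n).mul hG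
    calc ∫⁻ ω, F ω ∂T = ∫⁻ ω, F (snoc ω (ω n)) ∂T := lintegral_congr hFsnoc
      _ = ∫⁻ ω, ∫⁻ e, d n ω e * F (snoc ω e) ∂m ∂T := h n _ hG hGdep
      _ = ∫⁻ ω, (∫⁻ e, d n ω e * F (snoc ω e) ∂m) * D n ω ∂iidLaw m := by
          refine ih _ hdG.lintegral_prod_right' fun ω ω' hag => lintegral_congr fun e => ?_
          rw [hdep n _ _ e hag, hGdep _ _ e hag]
      _ = ∫⁻ ω, ∫⁻ e, d n ω e * F (snoc ω e) * D n ω ∂m ∂iidLaw m := by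
          refine lintegral_congr fun ω => (lintegral_mul_const _ ?_).symm
          exact hdG.comp measurable_prodMk_left
      _ = ∫⁻ ω, d n ω (ω n) * F (snoc ω (ω n)) * D n ω ∂iidLaw m := by
          refine lintegral_next m n (F := fun ω e => d n ω e * F (snoc ω e) * D n ω)
            (hdG.mul ((hD n).comp measurable_fst)) fun ω ω' e hag => ?_
          rw [hdep n _ _ e hag, hGdep _ _ e hag, hDdep n _ _ hag]
      _ = ∫⁻ ω, F ω * D (n + 1) ω ∂iidLaw m := by
          refine lintegral_congr fun ω => ?_
          rw [← hFsnoc, hDsucc]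
          ring

/-- Harmonicity makes each `stepDensity` integrate to one, and their products telescope to
`walkDensity`. From a negative position the step density is set to `1`; the product has already
vanished there. -/
theorem exists_conditioned_walk (h : IsCenteredStep m g) {x : ℝ} (hx : 0 ≤ x) :
    ∃ T : Measure (ℕ → E), IsProbabilityMeasure T ∧
      ∀ (n : ℕ) (F : (ℕ → E) → ℝ≥0∞), Measurable F →
        (∀ ω ω', (∀ i < n, ω i = ω' i) → F ω = F ω') →
        ∫⁻ ω, F ω ∂T = ∫⁻ ω, F ω * walkDensity m g x n ω ∂iidLaw m := by
  classical
  have hg := h.measurable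
  have hfin := descRenewal_ne_top m hg h.neg
  have hne : ∀ y, 0 ≤ y → descRenewal m g y ≠ 0 := fun y hy =>
    (zero_lt_one.trans_le (one_le_descRenewal m hy)).ne'
  refine exists_measure_of_density_process (d := stepDensity m g x) ?_ ?_ ?_
    (measurable_walkDensity hg x) ?_ ?_ ?_
  · intro n
    have hw : Measurable fun p : (ℕ → E) × E => x + walk g n p.1 :=
      ((measurable_walk hg n).comp measurable_fst).const_add x
    refine Measurable.ite (measurableSet_le measurable_const hw) ?_ measurable_const
    exact (measurable_descRenewal.comp (hw.add (hg.comp measurable_snd))).div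
      (measurable_descRenewal.comp hw)
  · intro n ω ω' e hag
    simp only [stepDensity, walk_congr g hag]
  · intro n ω
    by_cases h0 : 0 ≤ x + walk g n ω
    · simp only [stepDensity, h0, if_true, div_eq_mul_inv]
      rw [lintegral_mul_const _ (measurable_descRenewal_add hg _), lintegral_descRenewal h h0,
        ENNReal.mul_inv_cancel (hne _ h0) (hfin _)]
    · simp [stepDensity, h0]
  · intro n ω ω' hag
    have hw : ∀ k ≤ n, walk g k ω = walk g k ω' := fun k hk =>
      walk_congr g fun i hi => hag i (hi.trans_le hk)
    have : (∀ k ≤ n, 0 ≤ x + walk g k ω) ↔ ∀ k ≤ n, 0 ≤ x + walk g k ω' :=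
      forall₂_congr fun k hk => by rw [hw k hk]
    simp only [walkDensity, this, hw n le_rfl]
  · intro ω
    simp [walkDensity, hx, ENNReal.div_self (hne x hx) (hfin x)]
  · intro n ω
    by_cases hn : ∀ k ≤ n, 0 ≤ x + walk g k ω
    · have h1 := hn n le_rfl
      have h2 : walkDensity m g x (n + 1) ω =
          descRenewal m g (x + walk g (n + 1) ω) / descRenewal m g x := by
        by_cases h3 : 0 ≤ x + walk g (n + 1) ω
        · refine if_pos fun k hk => ?_
          rcases hk.lt_or_eq with hk | rfl
          · exact hn k (by omega)
          · exact h3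
        -- A step below zero is killed automatically, since the renewal function vanishes on the
        -- negative half-line.
        · rw [descRenewal_of_neg m (not_le.1 h3), ENNReal.zero_div]
          exact if_neg fun hall => h3 (hall _ le_rfl)
      rw [h2, walkDensity, if_pos hn, stepDensity, if_pos h1, walk_succ, add_assoc, div_eq_mul_inv,
        div_eq_mul_inv, div_eq_mul_inv, mul_comm (descRenewal m g (x + walk g n ω)), mul_assoc,
        mul_left_comm (descRenewal m g (x + walk g n ω)),
        ENNReal.mul_inv_cancel (hne _ h1) (hfin _), mul_one, mul_comm]
    · have h2 : ¬ ∀ k ≤ n + 1, 0 ≤ x + walk g k ω := fun hall => hn fun k hk => hall k (by omega)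
      simp only [walkDensity, hn, h2, if_false, zero_mul]

end Existence

/-! ### Existence of the law `P⁺_x` -/

section PositiveLaw

variable {Θ : Measure Offspring}

theorem rayVertex_congr {r r' : ℕ → ℕ} {n : ℕ} (h : ∀ i < n, r i = r' i) :
    rayVertex r n = rayVertex r' n := by
  induction n with
  | zero => rfl
  | succ n ih => rw [rayVertex, rayVertex, h n (by omega), ih fun i hi => h i (by omega)]

theorem noisePosition_congr (x : ℝ) {ν ν' : Noise} {n : ℕ} (h1 : ν.1 = ν'.1)
    (h2 : ∀ i < n, ν.2 i = ν'.2 i) {u : Vertex} (hu : u.length ≤ n) :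
    noisePosition x ν u = noisePosition x ν' u := by
  induction u with
  | nil => rfl
  | cons i u ih =>
    have hu' : u.length < n := by simpa using hu
    have h3 : rayVertex (noiseRay ν) u.length = rayVertex (noiseRay ν') u.length :=
      rayVertex_congr fun j hj => by simp only [noiseRay, h2 j (hj.trans hu')]
    rw [noisePosition, noisePosition, ih hu'.le]
    simp only [noiseOffspring, h3, h1, h2 _ hu']

theorem noisePath_mem_iff (x : ℝ) {ν ν' : Noise} {n : ℕ} (h1 : ν.1 = ν'.1)
    (h2 : ∀ i < n, ν.2 i = ν'.2 i) {A : Set Path} (hA : MeasurableSet[sigmaUpTo n] A) :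
    noisePath x ν ∈ A ↔ noisePath x ν' ∈ A := by
  -- Only the factorization of `F_n`-events through `Φ` matters, so the target may carry the
  -- σ-algebra `⊤`.
  let Φ (ω : Path) : ({u : Vertex // u.length ≤ n} → WithTop ℝ) × ({k : ℕ // k ≤ n} → Vertex) :=
    (fun u => ω.1 u, fun k => spine k ω)
  have hle : sigmaUpTo n ≤ MeasurableSpace.comap Φ ⊤ := by
    refine sup_le (iSup₂_le fun u hu => ?_) (iSup₂_le fun k hk => ?_)
    · rintro _ ⟨B, -, rfl⟩
      exact ⟨{p | p.1 ⟨u, hu⟩ ∈ B}, trivial, rfl⟩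
    · rintro _ ⟨B, -, rfl⟩
      exact ⟨{p | p.2 ⟨k, hk⟩ ∈ B}, trivial, rfl⟩
  obtain ⟨B, -, rfl⟩ := hle A hA
  have : Φ (noisePath x ν) = Φ (noisePath x ν') := by
    refine Prod.ext (funext fun u => noisePosition_congr x h1 h2 u.2) (funext fun k => ?_)
    exact rayVertex_congr fun i hi => by
      simp only [noisePath, noiseRay, h2 i (hi.trans_le k.2)]
  simp only [Set.mem_preimage, this]

theorem measurable_positiveDensity (hΘ : IsBoundaryCase Θ) (x : ℝ) (n : ℕ) :
    Measurable (positiveDensity Θ x n) := by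
  classical
  have := isProbabilityMeasure_spineStep hΘ
  have hm := measurable_spinePos
  unfold positiveDensity
  rw [renewal_eq_descRenewal hΘ]
  refine Measurable.ite ?_ ?_ measurable_const
  · simp only [measurableSet_setOfPred]; fun_prop
  · exact (measurable_descRenewal.comp (hm n)).div_const _

theorem positiveDensity_noisePath (hΘ : IsBoundaryCase Θ) (x : ℝ) (n : ℕ) {ν : Noise}
    (hν : ∀ i, (ν.2 i).1 (ν.2 i).2 ≠ ⊤) :
    positiveDensity Θ x n (noisePath x ν) = walkDensity (spineStep Θ) displacement x n ν.2 := by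
  simp only [positiveDensity, walkDensity, spinePos_noisePath x hν, renewal_eq_descRenewal hΘ]

/-- Replace only the spine noise by the conditioned walk. For fixed noise off the spine, an event of
`F_n` depends on the first `n` spine steps, where the density is known. -/
theorem exists_isPositiveSpineLaw (hΘ : IsBoundaryCase Θ) {x : ℝ} (hx : 0 ≤ x) :
    ∃ Q : Measure Path, IsPositiveSpineLaw Θ x Q := by
  have := isProbabilityMeasure_spineStep hΘ
  have := hΘ.prob
  obtain ⟨T, hT, hTd⟩ := exists_conditioned_walk (isCenteredStep_spineStep hΘ) hx
  have hΨ := measurable_noisePath x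
  refine ⟨((Measure.infinitePi fun _ : Vertex => Θ).prod T).map (noisePath x),
    Measure.isProbabilityMeasure_map hΨ.aemeasurable, fun n A hA => ?_⟩
  have hA' : MeasurableSet A := sigmaUpTo_le n A hA
  have hΨA := hΨ hA'
  have hone : Measurable ((noisePath x ⁻¹' A).indicator (1 : Noise → ℝ≥0∞)) :=
    measurable_one.indicator hΨA
  have hw : Measurable fun ν : Noise => walkDensity (spineStep Θ) displacement x n ν.2 :=
    (measurable_walkDensity measurable_displacement x n).comp measurable_snd
  rw [Measure.map_apply hΨ hA', spinalLaw_eq_map, setLIntegral_map hA'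
    (measurable_positiveDensity hΘ x n) hΨ, ← lintegral_indicator hΨA,
    ← lintegral_indicator_one hΨA, lintegral_prod _ hone.aemeasurable]
  calc ∫⁻ ν₁, ∫⁻ ω, (noisePath x ⁻¹' A).indicator (1 : Noise → ℝ≥0∞) (ν₁, ω) ∂T
        ∂(Measure.infinitePi fun _ : Vertex => Θ)
      = ∫⁻ ν₁, ∫⁻ ω, (noisePath x ⁻¹' A).indicator (1 : Noise → ℝ≥0∞) (ν₁, ω) *
          walkDensity (spineStep Θ) displacement x n ω ∂iidLaw (spineStep Θ)
          ∂(Measure.infinitePi fun _ : Vertex => Θ) := by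
        refine lintegral_congr fun ν₁ => hTd n _ (hone.comp measurable_prodMk_left) ?_
        intro ω ω' hag
        have := noisePath_mem_iff x (ν := (ν₁, ω)) (ν' := (ν₁, ω')) rfl hag hA
        by_cases hmem : noisePath x (ν₁, ω) ∈ A
        · rw [Set.indicator_of_mem (show (ν₁, ω) ∈ noisePath x ⁻¹' A from hmem),
            Set.indicator_of_mem (show (ν₁, ω') ∈ noisePath x ⁻¹' A from this.1 hmem)]
          rfl
        · rw [Set.indicator_of_notMem (show (ν₁, ω) ∉ noisePath x ⁻¹' A from hmem),
            Set.indicator_of_notMem (show (ν₁, ω') ∉ noisePath x ⁻¹' A from mt this.2 hmem)]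
    _ = ∫⁻ ν, (noisePath x ⁻¹' A).indicator (1 : Noise → ℝ≥0∞) ν *
          walkDensity (spineStep Θ) displacement x n ν.2 ∂noiseLaw Θ :=
        (lintegral_prod _ (hone.mul hw).aemeasurable).symm
    _ = _ := by
        refine lintegral_congr_ae ?_
        filter_upwards [ae_noiseLaw_ne_top hΘ] with ν hν
        by_cases hmem : ν ∈ noisePath x ⁻¹' A
        · simp only [Set.indicator_of_mem hmem, Pi.one_apply, one_mul,
            positiveDensity_noisePath hΘ x n hν]
        · simp only [Set.indicator_of_notMem hmem, zero_mul]

end PositiveLaw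

/-! ### Potential of the spine under `P⁺_x` -/

section Potential

variable {Θ : Measure Offspring}

theorem IsPositiveSpineLaw.ae_nonneg {x : ℝ} {Q : Measure Path} (hQ : IsPositiveSpineLaw Θ x Q) :
    ∀ᵐ ω ∂Q, ∀ k, 0 ≤ spinePos k ω := by
  rw [ae_all_iff]
  intro k
  have hs : MeasurableSet[sigmaUpTo k] {ω : Path | spinePos k ω < 0} :=
    measurable_sigmaUpTo_spinePos le_rfl measurableSet_Iio
  rw [ae_iff]
  simp only [not_le]
  rw [hQ.density k _ hs, setLIntegral_congr_fun (g := 0) (sigmaUpTo_le k _ hs)]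
  · simp
  · intro ω hω
    exact if_neg fun h => (h k le_rfl).not_gt hω

theorem IsPositiveSpineLaw.measure_Ico_le (hΘ : IsBoundaryCase Θ) {x : ℝ} {Q : Measure Path}
    (hQ : IsPositiveSpineLaw Θ x Q) (k : ℕ) (a : ℝ) :
    Q {ω | a ≤ spinePos k ω ∧ spinePos k ω < a + 1} ≤ renewal Θ (a + 1) / renewal Θ x *
      iidLaw (spineStep Θ) {ω | a ≤ x + walk displacement k ω ∧
        x + walk displacement k ω ≤ a + 1 ∧ ∀ j ≤ k, 0 ≤ x + walk displacement j ω} := by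
  have := isProbabilityMeasure_spineStep hΘ
  have hs : MeasurableSet[sigmaUpTo k] {ω : Path | a ≤ spinePos k ω ∧ spinePos k ω < a + 1} :=
    measurable_sigmaUpTo_spinePos le_rfl measurableSet_Ico
  have hs' := sigmaUpTo_le k _ hs
  have hB : MeasurableSet {s : ℕ → ℝ | a ≤ s k ∧ s k ≤ a + 1 ∧ ∀ j ≤ k, 0 ≤ s j} := by
    simp only [measurableSet_setOfPred]; fun_prop
  have hB' : MeasurableSet {ω : Path | a ≤ spinePos k ω ∧ spinePos k ω ≤ a + 1 ∧
      ∀ j ≤ k, 0 ≤ spinePos j ω} :=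
    (measurable_pi_lambda (fun (ω : Path) (k : ℕ) => spinePos k ω) measurable_spinePos) hB
  have hlaw := spinalLaw_apply hΘ x hB
  simp only [Set.mem_ofPred_eq] at hlaw
  rw [hQ.density k _ hs, ← hlaw, ← lintegral_indicator hs', ← lintegral_indicator_one hB',
    ← lintegral_const_mul _ (measurable_one.indicator hB')]
  refine lintegral_mono fun ω => ?_
  by_cases h1 : ω ∈ {ω : Path | a ≤ spinePos k ω ∧ spinePos k ω < a + 1}
  · rw [Set.indicator_of_mem h1, positiveDensity]
    split_ifs with h2
    · rw [Set.indicator_of_mem (show ω ∈ {ω : Path | a ≤ spinePos k ω ∧ spinePos k ω ≤ a + 1 ∧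
        ∀ j ≤ k, 0 ≤ spinePos j ω} from ⟨h1.1, h1.2.le, h2⟩), Pi.one_apply, mul_one,
        renewal_eq_descRenewal hΘ]
      exact ENNReal.div_le_div_right (descRenewal_mono _ h1.2.le) _
    · exact bot_le
  · rw [Set.indicator_of_notMem h1]
    exact bot_le

/-- The ladder mass `Z` is bounded by `R(x)`, dropping the upper constraint, and by `K (a + 2)`,
since its interval has length `a + 1`. The first bound gives domination uniform in `x`, the second
decay as `x → ∞`. -/
theorem exists_potential_bound (hΘ : IsBoundaryCase Θ) :
    ∃ C K : ℝ≥0∞, C ≠ ∞ ∧ K ≠ ∞ ∧ ∀ x : ℝ, 0 ≤ x → ∀ Q : Measure Path,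
      IsPositiveSpineLaw Θ x Q → ∀ a : ℕ,
      ∑' k : ℕ, Q {ω | (a : ℝ) ≤ spinePos k ω ∧ spinePos k ω < a + 1} ≤
        renewal Θ (a + 1) * (C * min 1 (K * (a + 2) / renewal Θ x)) := by
  have := isProbabilityMeasure_spineStep hΘ
  have hstep := isCenteredStep_spineStep hΘ
  obtain ⟨C, hC, hgreen⟩ := exists_green_bound (spineStep Θ) hstep.measurable hstep.pos
  obtain ⟨K, hK, hdesc⟩ := exists_strictDescent_bound (spineStep Θ) hstep.measurable hstep.neg
  refine ⟨C, K, hC, hK, fun x hx Q hQ a => ?_⟩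
  set Z := ∑' n : ℕ, iidLaw (spineStep Θ) {ω | -x ≤ walk displacement n ω ∧
    walk displacement n ω ≤ a + 1 - x ∧ ω ∈ strictDescent displacement n}
  have hRx : renewal Θ x = descRenewal (spineStep Θ) displacement x := by
    rw [renewal_eq_descRenewal hΘ]
  have hR0 : renewal Θ x ≠ 0 := by
    rw [hRx]; exact (zero_lt_one.trans_le (one_le_descRenewal _ hx)).ne'
  have hRt : renewal Θ x ≠ ∞ := by
    rw [hRx]; exact descRenewal_ne_top _ hstep.measurable hstep.neg x
  have hZ1 : Z ≤ renewal Θ x := by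
    rw [hRx]
    exact ENNReal.tsum_le_tsum fun n => measure_mono fun ω hω => ⟨hω.1, hω.2.2⟩
  have hZ2 : Z ≤ K * (a + 2) := by
    have h := hdesc x (a + 1)
    have h1 : (((a + 1 : ℕ) : ℝ≥0∞) + 1) = a + 2 := by push_cast; ring
    rw [h1] at h
    refine le_trans (ENNReal.tsum_le_tsum fun n => measure_mono ?_) h
    rintro ω ⟨h1, h2, h3⟩
    refine ⟨h1, ?_, h3⟩
    push_cast
    linarith
  calc ∑' k : ℕ, Q {ω | (a : ℝ) ≤ spinePos k ω ∧ spinePos k ω < a + 1}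
      ≤ ∑' k : ℕ, renewal Θ (a + 1) / renewal Θ x *
        iidLaw (spineStep Θ) {ω | (a : ℝ) ≤ x + walk displacement k ω ∧
          x + walk displacement k ω ≤ a + 1 ∧ ∀ j ≤ k, 0 ≤ x + walk displacement j ω} :=
        ENNReal.tsum_le_tsum fun k => hQ.measure_Ico_le hΘ k a
    _ ≤ renewal Θ (a + 1) / renewal Θ x * (C * Z) := by
        rw [ENNReal.tsum_mul_left]
        gcongr
        exact hgreen x a
    _ = renewal Θ (a + 1) * (C * (Z / renewal Θ x)) := by
        simp only [div_eq_mul_inv]; ring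
    _ ≤ renewal Θ (a + 1) * (C * min 1 (K * (a + 2) / renewal Θ x)) := by
        gcongr
        refine le_min ?_ (ENNReal.div_le_div_right hZ2 _)
        exact (ENNReal.div_le_div_right hZ1 _).trans (ENNReal.div_self hR0 hRt).le

variable {f : ℝ → ℝ}

theorem ofReal_le_tsum_indicator (hf_anti : AntitoneOn f (Set.Ici 0)) {s : ℝ} (hs : 0 ≤ s) :
    ENNReal.ofReal (f s) ≤ ∑' a : ℕ, ENNReal.ofReal (f a) *
      Set.indicator {s : ℝ | (a : ℝ) ≤ s ∧ s < a + 1} 1 s := by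
  refine le_trans ?_ (ENNReal.le_tsum ⌊s⌋₊)
  have h1 := Nat.floor_le hs
  rw [Set.indicator_of_mem (show s ∈ {t : ℝ | ((⌊s⌋₊ : ℕ) : ℝ) ≤ t ∧ t < (⌊s⌋₊ : ℕ) + 1} from
    ⟨h1, Nat.lt_floor_add_one s⟩), Pi.one_apply, mul_one]
  exact ENNReal.ofReal_le_ofReal (hf_anti (Set.mem_Ici.2 (Nat.cast_nonneg _)) hs h1)

theorem lintegral_potential_le (hf_anti : AntitoneOn f (Set.Ici 0)) {x : ℝ} {Q : Measure Path}
    (hQ : IsPositiveSpineLaw Θ x Q) :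
    ∫⁻ ω, ∑' k : ℕ, ENNReal.ofReal (f (spinePos k ω)) ∂Q ≤
      ∑' a : ℕ, ENNReal.ofReal (f a) *
        ∑' k : ℕ, Q {ω | (a : ℝ) ≤ spinePos k ω ∧ spinePos k ω < a + 1} := by
  have hm : ∀ a k : ℕ, Measurable fun ω : Path =>
      Set.indicator {s : ℝ | (a : ℝ) ≤ s ∧ s < a + 1} (1 : ℝ → ℝ≥0∞) (spinePos k ω) := fun a k =>
    (measurable_one.indicator measurableSet_Ico).comp (measurable_spinePos k)
  calc ∫⁻ ω, ∑' k : ℕ, ENNReal.ofReal (f (spinePos k ω)) ∂Q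
      ≤ ∫⁻ ω, ∑' k : ℕ, ∑' a : ℕ, ENNReal.ofReal (f a) *
          Set.indicator {s : ℝ | (a : ℝ) ≤ s ∧ s < a + 1} 1 (spinePos k ω) ∂Q := by
        refine lintegral_mono_ae ?_
        filter_upwards [hQ.ae_nonneg] with ω hω
        exact ENNReal.tsum_le_tsum fun k => ofReal_le_tsum_indicator hf_anti (hω k)
    _ = ∑' k : ℕ, ∑' a : ℕ, ENNReal.ofReal (f a) *
          Q {ω | (a : ℝ) ≤ spinePos k ω ∧ spinePos k ω < a + 1} := by
        rw [lintegral_tsum fun k =>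
          (Measurable.tsum fun a => (hm a k).const_mul _).aemeasurable]
        refine tsum_congr fun k => ?_
        rw [lintegral_tsum fun a => ((hm a k).const_mul _).aemeasurable]
        refine tsum_congr fun a => ?_
        rw [lintegral_const_mul _ (hm a k)]
        congr 1
        exact lintegral_indicator_one (measurable_spinePos k measurableSet_Ico)
    _ = _ := by
        rw [ENNReal.tsum_comm]
        exact tsum_congr fun a => ENNReal.tsum_mul_left

theorem tsum_mul_ofReal_ne_top (hf_nonneg : ∀ y, 0 ≤ y → 0 ≤ f y)
    (hf_anti : AntitoneOn f (Set.Ici 0))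
    (hf_int : IntegrableOn (fun y => y * f y) (Set.Ioi 0)) :
    ∑' a : ℕ, ENNReal.ofReal (f a) * (a + 2) ≠ ∞ := by
  have hint : ∫⁻ y in Set.Ioi (0 : ℝ), ENNReal.ofReal (y * f y) ≠ ∞ :=
    hf_int.lintegral_lt_top.ne
  have hblock : ∀ b : ℕ, ENNReal.ofReal (b * f (b + 1)) ≤
      ∫⁻ y in Set.Ioc (b : ℝ) ((b + 1 : ℕ) : ℝ), ENNReal.ofReal (y * f y) := by
    intro b
    calc ENNReal.ofReal (b * f (b + 1))
        = ∫⁻ _ in Set.Ioc (b : ℝ) ((b + 1 : ℕ) : ℝ), ENNReal.ofReal (b * f (b + 1)) := by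
          simp
      _ ≤ _ := by
          refine setLIntegral_mono' measurableSet_Ioc fun y hy => ENNReal.ofReal_le_ofReal ?_
          have hb : (0 : ℝ) ≤ b := Nat.cast_nonneg b
          have hy0 : 0 ≤ y := hb.trans hy.1.le
          have hy1 : y ≤ b + 1 := by simpa using hy.2
          exact mul_le_mul hy.1.le (hf_anti hy0 (by simp only [Set.mem_Ici]; positivity) hy1)
            (hf_nonneg _ (by positivity)) hy0
  have hsum : ∑' b : ℕ, ENNReal.ofReal (b * f (b + 1)) ≠ ∞ := by
    refine ne_top_of_le_ne_top hint ((ENNReal.tsum_le_tsum hblock).trans ?_)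
    rw [← lintegral_iUnion (s := fun b : ℕ => Set.Ioc (b : ℝ) ((b + 1 : ℕ) : ℝ))
      (fun b => measurableSet_Ioc)
      (Monotone.pairwise_disjoint_on_Ioc_succ (Nat.mono_cast (α := ℝ)))]
    refine lintegral_mono_set (Set.iUnion_subset fun b y hy => ?_)
    exact (Nat.cast_nonneg b).trans_lt hy.1
  -- The terms `a = 0, 1` are finite on their own. For `a = c + 2` the weight `c + 4` is at most `4
  -- (c + 1)`, which matches the block bound with `b = c + 1`.
  rw [tsum_eq_zero_add' ENNReal.summable, tsum_eq_zero_add' ENNReal.summable]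
  refine ENNReal.add_ne_top.2 ⟨ENNReal.mul_ne_top ENNReal.ofReal_ne_top (by simp),
    ENNReal.add_ne_top.2 ⟨ENNReal.mul_ne_top ENNReal.ofReal_ne_top (by simp), ?_⟩⟩
  refine ne_top_of_le_ne_top (ENNReal.mul_ne_top (by simp : (4 : ℝ≥0∞) ≠ ∞) hsum) ?_
  rw [← ENNReal.tsum_mul_left, tsum_eq_zero_add' (f := fun b : ℕ =>
    4 * ENNReal.ofReal (b * f (b + 1))) ENNReal.summable]
  refine le_trans (ENNReal.tsum_le_tsum fun c => ?_) le_add_self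
  have hc : (0 : ℝ) ≤ c := Nat.cast_nonneg c
  have h0 : 0 ≤ f ((c : ℝ) + 1 + 1) := hf_nonneg _ (by positivity)
  have e1 : (((c + 1 + 1 : ℕ) : ℝ≥0∞) + 2) = ENNReal.ofReal ((c : ℝ) + 4) := by
    rw [ENNReal.ofReal_add hc (by norm_num), ENNReal.ofReal_natCast]
    push_cast
    rw [ENNReal.ofReal_ofNat]
    ring
  rw [e1, ← ENNReal.ofReal_mul' (by positivity), ← ENNReal.ofReal_ofNat 4,
    ← ENNReal.ofReal_mul (by norm_num)]
  refine ENNReal.ofReal_le_ofReal ?_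
  push_cast
  nlinarith

theorem tsum_renewal_ne_top (hΘ : IsBoundaryCase Θ) (hf_nonneg : ∀ y, 0 ≤ y → 0 ≤ f y)
    (hf_anti : AntitoneOn f (Set.Ici 0))
    (hf_int : IntegrableOn (fun y => y * f y) (Set.Ioi 0)) :
    ∑' a : ℕ, ENNReal.ofReal (f a) * renewal Θ (a + 1) ≠ ∞ := by
  have := isProbabilityMeasure_spineStep hΘ
  have hstep := isCenteredStep_spineStep hΘ
  obtain ⟨C, hC, h⟩ := exists_descRenewal_bound (spineStep Θ) hstep.measurable hstep.neg
  refine ne_top_of_le_ne_top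
    (ENNReal.mul_ne_top hC (tsum_mul_ofReal_ne_top hf_nonneg hf_anti hf_int)) ?_
  rw [← ENNReal.tsum_mul_left, renewal_eq_descRenewal hΘ]
  refine ENNReal.tsum_le_tsum fun a => ?_
  have h1 := h (a + 1)
  push_cast at h1
  rw [mul_left_comm]
  gcongr
  refine h1.trans_eq ?_
  congr 1
  ring

/-- Dominated convergence for the counting measure: `u` dominates, and each term vanishes because
`R(x) → ∞`. -/
theorem tendsto_tsum_potential (hΘ : IsBoundaryCase Θ) {u : ℕ → ℝ≥0∞} (hu : ∑' a, u a ≠ ∞)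
    {K : ℝ≥0∞} (hK : K ≠ ∞) :
    Tendsto (fun x => ∑' a : ℕ, u a * min 1 (K * (a + 2) / renewal Θ x)) atTop (𝓝 0) := by
  have := isProbabilityMeasure_spineStep hΘ
  have hlim := tendsto_descRenewal (isCenteredStep_spineStep hΘ)
  rw [← renewal_eq_descRenewal hΘ] at hlim
  simp_rw [← lintegral_count]
  have h := tendsto_lintegral_filter_of_dominated_convergence (μ := Measure.count) (l := atTop)
    (F := fun (x : ℝ) (a : ℕ) => u a * min 1 (K * (a + 2) / renewal Θ x)) (f := fun _ => 0) u
    (.of_forall fun x => measurable_of_countable _)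
    (.of_forall fun x => .of_forall fun a => mul_le_of_le_one_right' (min_le_left _ _))
    (by rwa [lintegral_count]) (.of_forall fun a => ?_)
  · simpa using h
  · have hW : K * ((a : ℝ≥0∞) + 2) ≠ ∞ := ENNReal.mul_ne_top hK (by simp)
    have h1 : Tendsto (fun x => K * ((a : ℝ≥0∞) + 2) / renewal Θ x) atTop (𝓝 0) := by
      simpa using ENNReal.Tendsto.const_div hlim (.inr hW)
    have h2 : Tendsto (fun x => min 1 (K * ((a : ℝ≥0∞) + 2) / renewal Θ x)) atTop (𝓝 0) := by
      simpa using (tendsto_const_nhds (x := (1 : ℝ≥0∞))).min h1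
    simpa using ENNReal.Tendsto.const_mul (a := u a) h2
      (.inr (ne_top_of_le_ne_top hu (ENNReal.le_tsum a)))

end Potential

end SpinalBRW

end


/-! ### Conclusion -/

theorem mainTheorem4
    (Θ : Measure SpinalBRW.Offspring) (hΘ : SpinalBRW.IsBoundaryCase Θ)
    (f : ℝ → ℝ) (hf_nonneg : ∀ y, 0 ≤ y → 0 ≤ f y)
    (hf_bdd : ∃ C : ℝ, ∀ y, 0 ≤ y → f y ≤ C)
    (hf_anti : AntitoneOn f (Set.Ici 0))
    (hf_int : IntegrableOn (fun y => y * f y) (Set.Ioi 0)) :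
    (∀ x : ℝ, 0 ≤ x → ∃ Q : Measure SpinalBRW.Path, SpinalBRW.IsPositiveSpineLaw Θ x Q) ∧
    ∀ Pplus : ℝ → Measure SpinalBRW.Path,
      (∀ x : ℝ, 0 ≤ x → SpinalBRW.IsPositiveSpineLaw Θ x (Pplus x)) →
      Tendsto
        (fun x : ℝ => ∫⁻ ω, ∑' k : ℕ, ENNReal.ofReal (f (SpinalBRW.spinePos k ω)) ∂(Pplus x))
        atTop (𝓝 0) ∧
      ∀ x : ℝ, 0 ≤ x →
        ∫⁻ ω, ∑' k : ℕ, ENNReal.ofReal (f (SpinalBRW.spinePos k ω)) ∂(Pplus x) < ∞ := by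
  refine ⟨fun x hx => SpinalBRW.exists_isPositiveSpineLaw hΘ hx, fun Pplus hP => ?_⟩
  obtain ⟨C, K, hC, hK, hbound⟩ := SpinalBRW.exists_potential_bound hΘ
  set u : ℕ → ℝ≥0∞ := fun a => C * (ENNReal.ofReal (f a) * SpinalBRW.renewal Θ (a + 1))
  have hu : ∑' a, u a ≠ ∞ := by
    rw [ENNReal.tsum_mul_left]
    exact ENNReal.mul_ne_top hC (SpinalBRW.tsum_renewal_ne_top hΘ hf_nonneg hf_anti hf_int)
  have key : ∀ x : ℝ, 0 ≤ x →
      ∫⁻ ω, ∑' k : ℕ, ENNReal.ofReal (f (SpinalBRW.spinePos k ω)) ∂(Pplus x) ≤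
        ∑' a : ℕ, u a * min 1 (K * (a + 2) / SpinalBRW.renewal Θ x) := by
    intro x hx
    refine (SpinalBRW.lintegral_potential_le hf_anti (hP x hx)).trans
      (ENNReal.tsum_le_tsum fun a => ?_)
    calc _ ≤ ENNReal.ofReal (f a) * (SpinalBRW.renewal Θ (a + 1) *
            (C * min 1 (K * (a + 2) / SpinalBRW.renewal Θ x))) := by
          gcongr
          exact hbound x hx _ (hP x hx) a
      _ = u a * min 1 (K * (a + 2) / SpinalBRW.renewal Θ x) := by
          simp only [u]; ring
  constructor
  · refine tendsto_of_tendsto_of_tendsto_of_le_of_le' tendsto_const_nhds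
      (SpinalBRW.tendsto_tsum_potential hΘ hu hK) (.of_forall fun x => bot_le) ?_
    filter_upwards [eventually_ge_atTop 0] with x hx
    exact key x hx
  · intro x hx
    refine ((key x hx).trans (ENNReal.tsum_le_tsum fun a => ?_)).trans_lt hu.lt_top
    exact mul_le_of_le_one_right' (min_le_left _ _)
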